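/- Let $[n]=\{1,\dots,n\}$ and write a permutation of $[n]$ as a word $\sigma=\sigma_1\cdots\sigma_n$. An index $i$ with $1<i<n$ is a peak of $\sigma$ if $\sigma_{i-1}<\sigma_i>\sigma_{i+1}$. For $S\subseteq[n]$ let $P(S;n)$ be the number of permutations of $[n]$ whose set of peaks is $S$. If the peaks of $\sigma$ are $i_1<\cdots<i_k$, the peak-composition of $\sigma$ is the composition $(c_1,\dots,c_{k+1})$ of $n$ given by $c_j=i_j-i_{j-1}$, where $i_0=0$ and $i_{k+1}=n$. For a composition $\mathbf c$ of $n$ let $P(\mathbf c)$ be the number of permutations of $[n]$ with peak-composition $\mathbf c$. Call $\mathbf c$ maximal if $P(\mathbf b)\le P(\mathbf c)$ for every composition $\mathbf b$ of $n$, and let $\mathcal C^*(n)$ be the set of maximal compositions of $n$. Exponents in a composition denote repetition of a part. **Theorem.** For every integer $\ell\ge 2$, - $\mathcal C^*(3\ell)=\{(3^{\ell}),\,(4,3^{\ell-2},2)\}$; - $\mathcal C^*(3\ell+1)=\{(3^{s},2,3^{t},2) : s\ge 1,\ t\ge 0,\ s+t=\ell-1\}$; - $\mathcal C^*(3\ell+2)=\{(3^{\ell},2)\}$.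 Equivalently, for every $n\ge 6$, the sets $S\subseteq[n]$ that maximize $P(S;n)$ among all subsets of $[n]$ are exactly - if $n\equiv 0\pmod 3$: $\{3,6,9,\dots\}\cap[n-1]$ and $\{4,7,10,\dots\}\cap[n-1]$; - if $n\equiv 1\pmod 3$: $\{3,6,\dots,3s,\,3s+2,3s+5,3s+8,\dots\}\cap[n-1]$ with $1\le s\le\lfloor n/3\rfloor-1$; - if $n\equiv 2\pmod 3$: $\{3,6,9,\dots\}\cap[n-1]$. -/

import Mathlib

/-- `i` is a peak of `σ`, for the one-line word `σ₁ σ₂ … σₙ`: `σᵢ₋₁ < σᵢ > σᵢ₊₁`, with both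
neighbours present. Positions are counted from `1`, so position `i = j + 2` is the element
`j + 1` of `Fin n`. -/
def IsPeak {n : ℕ} (σ : Equiv.Perm (Fin n)) (i : ℕ) : Prop :=
  ∃ (j : ℕ) (h : j + 2 < n), i = j + 2 ∧
    σ ⟨j, by omega⟩ < σ ⟨j + 1, by omega⟩ ∧ σ ⟨j + 2, h⟩ < σ ⟨j + 1, by omega⟩

open Classical in
/-- The peak set of a permutation. All peaks lie in `[n]`. -/
noncomputable def peakSet {n : ℕ} (σ : Equiv.Perm (Fin n)) : Finset ℕ :=
  (Finset.Icc 1 n).filter (IsPeak σ)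

theorem mem_peakSet {n : ℕ} (σ : Equiv.Perm (Fin n)) (i : ℕ) :
    i ∈ peakSet σ ↔ IsPeak σ i := by
  classical
  unfold peakSet
  rw [Finset.mem_filter, Finset.mem_Icc]
  refine ⟨fun h => h.2, fun h => ⟨?_, h⟩⟩
  obtain ⟨j, hj, rfl, -⟩ := h
  omega

/-- `P(S; n)`: the number of permutations of `[n]` with peak set `S`. -/
noncomputable def numPeakSet (S : Finset ℕ) (n : ℕ) : ℕ :=
  Nat.card {σ : Equiv.Perm (Fin n) // peakSet σ = S}

open Classical in
/-- The peak-composition of `σ`: if the peaks are `i₁ < ⋯ < iₖ`, the parts are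
`iⱼ - iⱼ₋₁` for `j = 1, …, k + 1`, where `i₀ = 0` and `iₖ₊₁ = n`. The set of boundaries
is `{0, i₁, …, iₖ, n}`. -/
noncomputable def peakComposition {n : ℕ} (σ : Equiv.Perm (Fin n)) : Composition n :=
  CompositionAsSet.toComposition
    { boundaries := Finset.univ.filter
        (fun i : Fin n.succ => i = 0 ∨ (i : ℕ) ∈ peakSet σ ∨ i = Fin.last n)
      zero_mem := by simp
      getLast_mem := by simp }

/-- `P(c)`: the number of permutations of `[n]` with peak-composition `c`. -/
noncomputable def numPeakComposition {n : ℕ} (c : Composition n) : ℕ :=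
  Nat.card {σ : Equiv.Perm (Fin n) // peakComposition σ = c}

/-- The set of maximal compositions of `n`. -/
def maximalCompositions (n : ℕ) : Set (Composition n) :=
  {c | ∀ b : Composition n, numPeakComposition b ≤ numPeakComposition c}

/-- The subsets `S` of `[n]` that maximize `P(S; n)`. -/
def maximalPeakSets (n : ℕ) : Set (Finset ℕ) :=
  {S | S ⊆ Finset.Icc 1 n ∧ ∀ T ⊆ Finset.Icc 1 n, numPeakSet T n ≤ numPeakSet S n}

/-!
Encode the peak set of a word of length `n` by its list `d` of gaps between consecutive peaks,
where `0` and `n + 1` count as virtual peaks at the two ends. Then every gap is at least `2`, the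
gaps sum to `n + 1`, and the peak-composition is `d` with its last entry lowered by one. Let
`gapProb d` be the proportion of permutations of `[n]` with gap list `d`. The problem becomes to
maximize `gapProb d` among lists with a given sum.

The maximal letter of a word is a peak, where it cuts the gap list into those of the words on its
two sides, or it is at an end, where its removal lowers the outer gap by one. This gives the
recursion `gapProb_rec`, which is all that is used about permutations.

The gap `3` is special: the two letters inside it are unconstrained relative to each other, so the
word may be cut between them and `gapProb (L ++ 3 :: R) = gapProb (L ++ [2]) * gapProb (2 :: R)`
(`gapProb_append_three_cons`). Hence `gapProb d` is a product over the maximal pieces of `d` that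
contain no `3`. On these pieces the recursion gives decay like `(27 / 40) ^ d.sum` with good
constants (`gapProb_le`); this is faster than the `3 ^ (-d.sum / 3)` of a list of threes, so a
piece without `3` is never worth having if it is long. The few short pieces are evaluated exactly.

What remains is a competition among short pieces according to `d.sum` modulo `3`. It is governed by
`optFactor m`, the best value obtainable from a tail of sum `m`, which is submultiplicative,
strictly so when neither argument is divisible by `3` (`mul_le_optFactor_add`). So at most one piece
may differ from the empty one: a `4` at an end or a `2` in the interior. Thus the maximum is
`3 * optFactor d.sum`, and it is attained exactly by the lists in `IsOpt` (`gapProb_le_optFactor`,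
`IsOpt.gapProb_eq`). All positions of an interior `2` give the same product, which explains the
family of maximizers for `n ≡ 1` modulo `3`.
-/

/-! ### Gap lists of words -/

/-- The gap list of a word `l` with distinct entries: if `l` has length `n ≥ 1` and peaks
`i₁ < ⋯ < iₖ`, then `gaps l` lists the differences `iⱼ - iⱼ₋₁` for `j = 1, …, k + 1`, where
`i₀ = 0` and `iₖ₊₁ = n + 1`. Ending at `n + 1` rather than at `n` makes the notion symmetric
under reversal, and makes every gap at least `2`. -/
def gaps : List ℕ → List ℕ
  | [] => []
  | [_] => [2]
  | [_, _] => [3]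
  | a :: b :: c :: t =>
    if a < b ∧ c < b then 2 :: gaps (c :: t) else (gaps (b :: c :: t)).modifyHead (· + 1)

theorem gaps_cons_cons_cons (a b c : ℕ) (t : List ℕ) : gaps (a :: b :: c :: t) =
    if a < b ∧ c < b then 2 :: gaps (c :: t) else (gaps (b :: c :: t)).modifyHead (· + 1) := by
  rw [gaps]

theorem gaps_eq_nil_iff : ∀ l : List ℕ, gaps l = [] ↔ l = []
  | [] => by simp [gaps]
  | [_] => by simp [gaps]
  | [_, _] => by simp [gaps]
  | a :: b :: c :: t => by
    rw [gaps_cons_cons_cons]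
    split_ifs
    · simp
    · rw [List.modifyHead_eq_nil_iff, gaps_eq_nil_iff]; simp

theorem two_le_of_mem_gaps : ∀ l : List ℕ, ∀ a ∈ gaps l, 2 ≤ a
  | [] => by simp [gaps]
  | [_] => by simp [gaps]
  | [_, _] => by simp [gaps]
  | a :: b :: c :: t => by
    have h1 := two_le_of_mem_gaps (c :: t)
    have h2 := two_le_of_mem_gaps (b :: c :: t)
    rw [gaps_cons_cons_cons]
    split_ifs
    · simpa using h1
    · rcases hg : gaps (b :: c :: t) with _ | ⟨x, r⟩
      · simp
      · rw [hg] at h2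
        simp only [List.modifyHead_cons, List.mem_cons, forall_eq_or_imp] at h2 ⊢
        exact ⟨by omega, h2.2⟩

theorem sum_modifyHead_succ {d : List ℕ} (hd : d ≠ []) :
    (d.modifyHead (· + 1)).sum = d.sum + 1 := by
  rcases d with _ | ⟨a, t⟩
  · exact absurd rfl hd
  · simp only [List.modifyHead_cons, List.sum_cons]; omega

theorem sum_gaps : ∀ l : List ℕ, l ≠ [] → (gaps l).sum = l.length + 1
  | [], h => absurd rfl h
  | [_], _ => by simp [gaps]
  | [_, _], _ => by simp [gaps]
  | a :: b :: c :: t, _ => by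
    have h1 := sum_gaps (c :: t) (by simp)
    have h2 := sum_gaps (b :: c :: t) (by simp)
    rw [gaps_cons_cons_cons]
    split_ifs
    · simp only [List.sum_cons, h1, List.length_cons]; omega
    · rw [sum_modifyHead_succ (by rw [Ne, gaps_eq_nil_iff]; simp), h2]; simp

theorem modifyHead_append_of_ne_nil {α : Type*} (f : α → α) {l m : List α} (h : l ≠ []) :
    (l ++ m).modifyHead f = l.modifyHead f ++ m := by
  rcases l with _ | ⟨a, t⟩
  · exact absurd rfl h
  · simp

theorem gaps_cons_of_forall_lt {M : ℕ} {v : List ℕ} (hv : v ≠ []) (h : ∀ x ∈ v, x < M) :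
    gaps (M :: v) = (gaps v).modifyHead (· + 1) := by
  match v, hv with
  | [c], _ => simp [gaps]
  | c :: c' :: t, _ =>
    have : c < M := h c (by simp)
    rw [gaps_cons_cons_cons, if_neg (by omega)]

/-- A maximal letter inside a word is a peak, so the gap list of the word is the concatenation
of the gap lists of the two words on its sides. -/
theorem gaps_append_cons {M : ℕ} : ∀ {u v : List ℕ}, u ≠ [] → v ≠ [] →
    (∀ x ∈ u, x < M) → (∀ x ∈ v, x < M) → gaps (u ++ M :: v) = gaps u ++ gaps v
  | [], _, hu, _, _, _ => absurd rfl hu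
  | [a], v, _, hv, h1, h2 => by
    match v, hv with
    | c :: t, _ =>
      have : a < M := h1 a (by simp)
      have : c < M := h2 c (by simp)
      simp only [List.cons_append, List.nil_append]
      rw [gaps_cons_cons_cons, if_pos ⟨by omega, by omega⟩]
      simp [gaps]
  | [a, b], v, _, hv, h1, h2 => by
    have : b < M := h1 b (by simp)
    have := gaps_append_cons (u := [b]) (v := v) (by simp) hv (by simp; omega) h2
    simp only [List.cons_append, List.nil_append] at this ⊢
    obtain ⟨c, t, rfl⟩ := List.exists_cons_of_ne_nil hv
    rw [gaps_cons_cons_cons, if_neg (by omega), this]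
    simp [gaps]
  | a :: b :: c :: t, v, _, hv, h1, h2 => by
    have e1 := gaps_append_cons (u := c :: t) (v := v) (by simp) hv
      (fun x hx => h1 x (by simp at hx ⊢; tauto)) h2
    have e2 := gaps_append_cons (u := b :: c :: t) (v := v) (by simp) hv
      (fun x hx => h1 x (by simp at hx ⊢; tauto)) h2
    simp only [List.cons_append] at e1 e2 ⊢
    rw [gaps_cons_cons_cons, e1, e2, gaps_cons_cons_cons]
    split_ifs
    · simp
    · rw [modifyHead_append_of_ne_nil _ (by rw [Ne, gaps_eq_nil_iff]; simp)]

theorem gaps_concat_of_forall_lt {M : ℕ} : ∀ {u : List ℕ}, u ≠ [] → (∀ x ∈ u, x < M) →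
    gaps (u ++ [M]) = (gaps u).modifyLast (· + 1)
  | [], hu, _ => absurd rfl hu
  | [a], _, _ => rfl
  | [a, b], _, h1 => by
    have : b < M := h1 b (by simp)
    simp only [List.cons_append, List.nil_append]
    rw [gaps_cons_cons_cons, if_neg (by omega)]
    rfl
  | a :: b :: c :: t, _, h1 => by
    have e1 := gaps_concat_of_forall_lt (u := c :: t) (by simp)
      (fun x hx => h1 x (by simp at hx ⊢; tauto))
    have e2 := gaps_concat_of_forall_lt (u := b :: c :: t) (by simp)
      (fun x hx => h1 x (by simp at hx ⊢; tauto))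
    have n1 : gaps (c :: t) ≠ [] := by rw [Ne, gaps_eq_nil_iff]; simp
    have n2 : gaps (b :: c :: t) ≠ [] := by rw [Ne, gaps_eq_nil_iff]; simp
    simp only [List.cons_append] at e1 e2 ⊢
    rw [gaps_cons_cons_cons, e1, e2, gaps_cons_cons_cons]
    split_ifs
    · exact (List.modifyLast_append_of_right_ne_nil _ [2] _ n1).symm
    · rcases hg : gaps (b :: c :: t) with _ | ⟨x, r⟩
      · exact absurd hg n2
      · rcases List.eq_nil_or_concat r with rfl | ⟨r, y, rfl⟩
        · simp [List.modifyLast, List.modifyLast.go]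
        · have hx : x :: (r ++ [y]) = (x :: r) ++ [y] := rfl
          have hx' : (x + 1) :: (r ++ [y]) = ((x + 1) :: r) ++ [y] := rfl
          rw [List.concat_eq_append, hx, List.modifyLast_concat, List.cons_append, List.modifyHead_cons,
            List.cons_append, List.modifyHead_cons, hx', List.modifyLast_concat]
          rfl

/-! ### Counting arrangements by removing the maximal letter -/

/-- The words in which every element of `A` occurs exactly once. -/
def words (A : Finset ℕ) : Finset (List ℕ) := A.val.lists.toFinset

theorem mem_words {A : Finset ℕ} {l : List ℕ} : l ∈ words A ↔ l.Nodup ∧ l.toFinset = A := by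
  unfold words
  rw [Multiset.mem_toFinset, Multiset.mem_lists_iff]
  constructor
  · intro h
    have hn : l.Nodup := by
      have := A.nodup
      rw [h] at this
      exact Multiset.coe_nodup.1 this
    refine ⟨hn, ?_⟩
    ext x
    rw [List.mem_toFinset, ← Finset.mem_val, h]
    exact Multiset.mem_coe.symm
  · rintro ⟨hn, rfl⟩
    rw [List.toFinset_val, hn.dedup]
    rfl

theorem length_of_mem_words {A : Finset ℕ} {l : List ℕ} (h : l ∈ words A) :
    l.length = A.card := by
  obtain ⟨hn, rfl⟩ := mem_words.1 h
  exact (List.toFinset_card_of_nodup hn).symm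

theorem mem_iff_of_mem_words {A : Finset ℕ} {l : List ℕ} (h : l ∈ words A) {x : ℕ} :
    x ∈ l ↔ x ∈ A := by
  rw [← (mem_words.1 h).2, List.mem_toFinset]

/-- The number of nonempty arrangements of `A` with gap list `d`. -/
def numGaps (A : Finset ℕ) (d : List ℕ) : ℕ :=
  ((words A).filter fun l => l ≠ [] ∧ gaps l = d).card

theorem numGaps_empty (d : List ℕ) : numGaps ∅ d = 0 := by
  unfold numGaps
  rw [Finset.card_eq_zero, Finset.filter_eq_empty_iff]
  intro l hl h
  have := length_of_mem_words hl
  simp at this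
  exact h.1 this

theorem numGaps_eq_zero_of_sum_ne {A : Finset ℕ} {d : List ℕ} (h : d.sum ≠ A.card + 1) :
    numGaps A d = 0 := by
  unfold numGaps
  rw [Finset.card_eq_zero, Finset.filter_eq_empty_iff]
  rintro l hl ⟨h0, rfl⟩
  exact h (by rw [sum_gaps l h0, length_of_mem_words hl])

theorem numGaps_eq_zero_of_lt_two {A : Finset ℕ} {d : List ℕ} {a : ℕ} (ha : a ∈ d)
    (h : a < 2) : numGaps A d = 0 := by
  unfold numGaps
  rw [Finset.card_eq_zero, Finset.filter_eq_empty_iff]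
  rintro l hl ⟨h0, rfl⟩
  exact absurd (two_le_of_mem_gaps l a ha) (by omega)

theorem numGaps_singleton (x : ℕ) (d : List ℕ) :
    numGaps {x} d = if d = [2] then 1 else 0 := by
  have h : words {x} = {[x]} := by
    ext l
    rw [Finset.mem_singleton]
    constructor
    · intro hl
      have h1 := length_of_mem_words hl
      rw [Finset.card_singleton, List.length_eq_one_iff] at h1
      obtain ⟨a, rfl⟩ := h1
      have := (mem_iff_of_mem_words hl (x := a)).1 (by simp)
      simpa using this
    · rintro rfl
      rw [mem_words]; simp
  unfold numGaps
  rw [h, Finset.filter_singleton]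
  by_cases hd : d = [2]
  · simp [hd, gaps]
  · have : ¬ ([2] = d) := fun h => hd h.symm
    simp [hd, this, gaps]

section MaxRemoval

variable {A : Finset ℕ} {M : ℕ}

theorem append_cons_mem_words (hM : M ∉ A) {B : Finset ℕ} (hB : B ⊆ A) {u v : List ℕ}
    (hu : u ∈ words B) (hv : v ∈ words (A \ B)) : u ++ M :: v ∈ words (insert M A) := by
  rw [mem_words] at hu hv ⊢
  obtain ⟨hun, rfl⟩ := hu
  obtain ⟨hvn, hv⟩ := hv
  have hv' : ∀ x, x ∈ v ↔ x ∈ A ∧ x ∉ u := by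
    intro x
    rw [← List.mem_toFinset, hv, Finset.mem_sdiff, List.mem_toFinset]
  have hMu : M ∉ u := fun h => hM (hB (List.mem_toFinset.2 h))
  have hMv : M ∉ v := fun h => hM ((hv' M).1 h).1
  constructor
  · rw [List.nodup_append, List.nodup_cons]
    refine ⟨hun, ⟨hMv, hvn⟩, ?_⟩
    intro a ha b hb hab
    subst hab
    rcases List.mem_cons.1 hb with rfl | hb
    · exact hMu ha
    · exact ((hv' a).1 hb).2 ha
  · ext x
    simp only [List.mem_toFinset, List.mem_append, List.mem_cons, hv', Finset.mem_insert]
    have : x ∈ u → x ∈ A := fun h => hB (List.mem_toFinset.2 h)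
    tauto

/-- Splitting a word at its maximal letter `M`: an arrangement of `insert M A` is a set
`B ⊆ A` of letters to the left of `M`, an arrangement of `B` and one of `A \ B`. -/
theorem card_filter_words_insert (hM : M ∉ A) (P : List ℕ → Prop) [DecidablePred P] :
    ((words (insert M A)).filter P).card =
      ∑ B ∈ A.powerset, ((words B ×ˢ words (A \ B)).filter
        fun w => P (w.1 ++ M :: w.2)).card := by
  rw [← Finset.card_sigma]
  symm
  refine Finset.card_bij (fun w _ => w.2.1 ++ M :: w.2.2) ?_ ?_ ?_
  · rintro ⟨B, u, v⟩ h
    simp only [Finset.mem_sigma, Finset.mem_powerset, Finset.mem_filter,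
      Finset.mem_product] at h
    exact Finset.mem_filter.2 ⟨append_cons_mem_words hM h.1 h.2.1.1 h.2.1.2, h.2.2⟩
  · rintro ⟨B, u, v⟩ h ⟨B', u', v'⟩ h' he
    simp only [Finset.mem_sigma, Finset.mem_powerset, Finset.mem_filter,
      Finset.mem_product] at h h' he
    have h1 : M ∉ u := fun hu => hM (h.1 ((mem_iff_of_mem_words h.2.1.1).1 hu))
    have h2 : M ∉ u' := fun hu => hM (h'.1 ((mem_iff_of_mem_words h'.2.1.1).1 hu))
    have h3 : M ∉ v := fun hu =>
      hM (Finset.mem_sdiff.1 ((mem_iff_of_mem_words h.2.1.2).1 hu)).1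
    have h4 : M ∉ v' := fun hu =>
      hM (Finset.mem_sdiff.1 ((mem_iff_of_mem_words h'.2.1.2).1 hu)).1
    obtain ⟨rfl, -, rfl⟩ := (List.append_cons_inj_of_notMem h2 h4).1 he.symm
    obtain rfl : B = B' := by
      rw [← (mem_words.1 h.2.1.1).2, ← (mem_words.1 h'.2.1.1).2]
    rfl
  · intro l hl
    obtain ⟨hl, hP⟩ := Finset.mem_filter.1 hl
    have hMl : M ∈ l := (mem_iff_of_mem_words hl).2 (Finset.mem_insert_self _ _)
    obtain ⟨u, v, rfl⟩ := List.append_of_mem hMl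
    obtain ⟨hn, ht⟩ := mem_words.1 hl
    rw [List.nodup_append, List.nodup_cons] at hn
    obtain ⟨hun, ⟨hMv, hvn⟩, hd⟩ := hn
    have hMu : M ∉ u := fun h => hd M h M (by simp) rfl
    have hx : ∀ x, (x ∈ u ∨ x = M ∨ x ∈ v) ↔ x = M ∨ x ∈ A := by
      intro x
      rw [← Finset.mem_insert, ← ht, List.mem_toFinset, List.mem_append, List.mem_cons]
    refine ⟨⟨u.toFinset, u, v⟩, ?_, rfl⟩
    simp only [Finset.mem_sigma, Finset.mem_powerset, Finset.mem_filter,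
      Finset.mem_product]
    refine ⟨?_, ⟨mem_words.2 ⟨hun, rfl⟩, mem_words.2 ⟨hvn, ?_⟩⟩, hP⟩
    · intro x hxu
      rw [List.mem_toFinset] at hxu
      rcases (hx x).1 (Or.inl hxu) with rfl | h
      · exact absurd hxu hMu
      · exact h
    · ext x
      rw [Finset.mem_sdiff, List.mem_toFinset, List.mem_toFinset]
      constructor
      · intro hxv
        refine ⟨?_, fun hxu => hd x hxu x (by simp [hxv]) rfl⟩
        rcases (hx x).1 (Or.inr (Or.inr hxv)) with rfl | h
        · exact absurd hxv hMv
        · exact h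
      · rintro ⟨hxA, hxu⟩
        rcases (hx x).2 (Or.inr hxA) with h | rfl | h
        · exact absurd h hxu
        · exact absurd hxA hM
        · exact h

theorem modifyHead_succ_eq_iff {d e : List ℕ} (hd : ∀ a ∈ d, 2 ≤ a) :
    d.modifyHead (· + 1) = e ↔ d = e.modifyHead (· - 1) := by
  rcases d with _ | ⟨a, t⟩
  · rcases e with _ | ⟨b, s⟩ <;> simp
  · rcases e with _ | ⟨b, s⟩
    · simp
    · have := hd a (by simp)
      simp only [List.modifyHead_cons, List.cons.injEq]
      exact ⟨fun h => ⟨by omega, h.2⟩, fun h => ⟨by omega, h.2⟩⟩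

theorem modifyLast_nil {α : Type*} (f : α → α) : ([] : List α).modifyLast f = [] := rfl

theorem modifyLast_succ_eq_iff {d e : List ℕ} (hd : ∀ a ∈ d, 2 ≤ a) :
    d.modifyLast (· + 1) = e ↔ d = e.modifyLast (· - 1) := by
  rcases List.eq_nil_or_concat d with rfl | ⟨t, a, rfl⟩ <;>
  rcases List.eq_nil_or_concat e with rfl | ⟨s, b, rfl⟩ <;>
  simp only [List.concat_eq_append, List.modifyLast_concat, modifyLast_nil] at *
  · simp
  · simp
  · have := hd a (by simp)
    constructor
    · intro h
      obtain ⟨rfl, h2⟩ := List.append_inj' h rfl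
      rw [List.cons.injEq] at h2
      rw [← h2.1, Nat.add_sub_cancel]
    · intro h
      obtain ⟨rfl, h2⟩ := List.append_inj' h rfl
      rw [List.cons.injEq] at h2
      rw [show a + 1 = b by omega]

/-- The contribution of a nontrivial splitting: the gap lists of the two parts concatenate. -/
theorem card_filter_gaps_append (B C : Finset ℕ) (d : List ℕ) :
    ((words B ×ˢ words C).filter fun w => (w.1 ≠ [] ∧ w.2 ≠ []) ∧
      gaps w.1 ++ gaps w.2 = d).card =
      ∑ j ∈ Finset.range (d.length + 1), numGaps B (d.take j) * numGaps C (d.drop j) := by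
  rw [Finset.card_eq_sum_card_fiberwise (f := fun w => (gaps w.1).length)
    (t := Finset.range (d.length + 1))]
  · refine Finset.sum_congr rfl fun j hj => ?_
    rw [Finset.mem_range] at hj
    unfold numGaps
    rw [← Finset.card_product]
    congr 1
    ext ⟨u, v⟩
    simp only [Finset.mem_filter, Finset.mem_product]
    constructor
    · rintro ⟨⟨⟨hu, hv⟩, ⟨hu0, hv0⟩, rfl⟩, rfl⟩
      simp [hu, hv, hu0, hv0]
    · rintro ⟨⟨hu, hu0, hgu⟩, hv, hv0, hgv⟩
      refine ⟨⟨⟨hu, hv⟩, ⟨hu0, hv0⟩, by rw [hgu, hgv, List.take_append_drop]⟩, ?_⟩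
      rw [hgu, List.length_take]; omega
  · rintro ⟨u, v⟩ h
    simp only [Finset.coe_filter, Set.mem_ofPred_eq] at h
    simp only [Finset.coe_range, Set.mem_Iio]
    rw [← h.2.2, List.length_append]
    omega

/-- Removing the maximal letter `M`. It stands at a peak and splits the gap list, or at one of
the ends, where it lengthens the outer gap by one. -/
theorem numGaps_insert (hA : A.Nonempty) (hM : ∀ x ∈ A, x < M) (d : List ℕ) :
    numGaps (insert M A) d =
      (∑ B ∈ A.powerset, ∑ j ∈ Finset.range (d.length + 1),
        numGaps B (d.take j) * numGaps (A \ B) (d.drop j)) +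
      numGaps A (d.modifyHead (· - 1)) + numGaps A (d.modifyLast (· - 1)) := by
  have hMA : M ∉ A := fun h => lt_irrefl _ (hM M h)
  have key : ∀ B ∈ A.powerset, ((words B ×ˢ words (A \ B)).filter fun w =>
      w.1 ++ M :: w.2 ≠ [] ∧ gaps (w.1 ++ M :: w.2) = d).card =
      (∑ j ∈ Finset.range (d.length + 1),
        numGaps B (d.take j) * numGaps (A \ B) (d.drop j)) +
      (if B = ∅ then numGaps A (d.modifyHead (· - 1)) else 0) +
      (if B = A then numGaps A (d.modifyLast (· - 1)) else 0) := by
    intro B hB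
    rw [Finset.mem_powerset] at hB
    have w0 : words ∅ = {[]} := by
      ext l
      rw [mem_words, Finset.mem_singleton, List.toFinset_eq_empty_iff]
      exact ⟨fun h => h.2, fun h => ⟨by simp [h], h⟩⟩
    have hne : ∀ {C : Finset ℕ} {l : List ℕ}, C ≠ ∅ → l ∈ words C → l ≠ [] := by
      rintro C l hC hl rfl
      exact hC (by rw [← (mem_words.1 hl).2]; rfl)
    by_cases hB0 : B = ∅
    · subst hB0
      rw [if_pos rfl, if_neg hA.ne_empty.symm, Finset.sum_eq_zero, zero_add, add_zero,
        Finset.sdiff_empty, w0]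
      · unfold numGaps
        refine Finset.card_bij (fun w _ => w.2) ?_ ?_ ?_
        · rintro ⟨u, v⟩ h
          simp only [Finset.mem_filter, Finset.mem_product, Finset.mem_singleton] at h ⊢
          obtain ⟨⟨rfl, hv⟩, -, hg⟩ := h
          have hv0 := hne hA.ne_empty hv
          refine ⟨hv, hv0, ?_⟩
          rw [List.nil_append, gaps_cons_of_forall_lt hv0
            (fun x hx => hM x ((mem_iff_of_mem_words hv).1 hx)),
            modifyHead_succ_eq_iff (two_le_of_mem_gaps v)] at hg
          exact hg
        · rintro ⟨u, v⟩ h ⟨u', v'⟩ h' he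
          simp only [Finset.mem_filter, Finset.mem_product, Finset.mem_singleton] at h h' he
          rw [h.1.1, h'.1.1, he]
        · intro v hv
          obtain ⟨hv, hv0, hg⟩ := Finset.mem_filter.1 hv
          refine ⟨([], v), ?_, rfl⟩
          simp only [Finset.mem_filter, Finset.mem_product, Finset.mem_singleton]
          refine ⟨⟨trivial, hv⟩, by simp, ?_⟩
          rw [List.nil_append, gaps_cons_of_forall_lt hv0
            (fun x hx => hM x ((mem_iff_of_mem_words hv).1 hx)),
            modifyHead_succ_eq_iff (two_le_of_mem_gaps v)]
          exact hg
      · intro j _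
        rw [numGaps_empty, zero_mul]
    · by_cases hBA : B = A
      · subst hBA
        rw [if_neg hB0, if_pos rfl, Finset.sum_eq_zero, zero_add, zero_add,
          Finset.sdiff_self, w0]
        · unfold numGaps
          refine Finset.card_bij (fun w _ => w.1) ?_ ?_ ?_
          · rintro ⟨u, v⟩ h
            simp only [Finset.mem_filter, Finset.mem_product, Finset.mem_singleton] at h ⊢
            obtain ⟨⟨hu, rfl⟩, -, hg⟩ := h
            have hu0 := hne hB0 hu
            refine ⟨hu, hu0, ?_⟩
            rw [gaps_concat_of_forall_lt hu0
              (fun x hx => hM x ((mem_iff_of_mem_words hu).1 hx)),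
              modifyLast_succ_eq_iff (two_le_of_mem_gaps u)] at hg
            exact hg
          · rintro ⟨u, v⟩ h ⟨u', v'⟩ h' he
            simp only [Finset.mem_filter, Finset.mem_product, Finset.mem_singleton] at h h' he
            rw [h.1.2, h'.1.2, he]
          · intro u hu
            obtain ⟨hu, hu0, hg⟩ := Finset.mem_filter.1 hu
            refine ⟨(u, []), ?_, rfl⟩
            simp only [Finset.mem_filter, Finset.mem_product, Finset.mem_singleton]
            refine ⟨⟨hu, trivial⟩, by simp, ?_⟩
            rw [gaps_concat_of_forall_lt hu0
              (fun x hx => hM x ((mem_iff_of_mem_words hu).1 hx)),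
              modifyLast_succ_eq_iff (two_le_of_mem_gaps u)]
            exact hg
        · intro j _
          rw [Finset.sdiff_self, numGaps_empty, mul_zero]
      · rw [if_neg hB0, if_neg hBA, add_zero, add_zero, ← card_filter_gaps_append]
        congr 1
        refine Finset.filter_congr ?_
        rintro ⟨u, v⟩ h
        rw [Finset.mem_product] at h
        have hu0 := hne hB0 h.1
        have hv0 := hne (fun h => hBA (hB.antisymm (Finset.sdiff_eq_empty_iff_subset.1 h))) h.2
        dsimp only at *
        rw [gaps_append_cons hu0 hv0
          (fun x hx => hM x (hB ((mem_iff_of_mem_words h.1).1 hx)))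
          (fun x hx => hM x (Finset.mem_sdiff.1 ((mem_iff_of_mem_words h.2).1 hx)).1)]
        simp [hu0, hv0]
  have h0 : numGaps (insert M A) d = ∑ B ∈ A.powerset, ((words B ×ˢ words (A \ B)).filter
      fun w => w.1 ++ M :: w.2 ≠ [] ∧ gaps (w.1 ++ M :: w.2) = d).card :=
    card_filter_words_insert hMA _
  rw [h0, Finset.sum_congr rfl key, Finset.sum_add_distrib, Finset.sum_add_distrib,
    Finset.sum_ite_eq', Finset.sum_ite_eq', if_pos (Finset.empty_mem_powerset A),
    if_pos (Finset.mem_powerset_self A)]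

end MaxRemoval

/-! ### The recursion for probabilities -/

theorem numGaps_insert_of_card_le {n : ℕ}
    (ih : ∀ B : Finset ℕ, B.card ≤ n → ∀ d, numGaps B d = numGaps (Finset.range B.card) d)
    {A : Finset ℕ} {M : ℕ} (hn : A.card = n) (hA : A.Nonempty) (hM : ∀ x ∈ A, x < M)
    (d : List ℕ) :
    numGaps (insert M A) d = (∑ m ∈ Finset.range (n + 1), n.choose m *
      ∑ j ∈ Finset.range (d.length + 1), numGaps (Finset.range m) (d.take j) *
        numGaps (Finset.range (n - m)) (d.drop j)) +
      numGaps (Finset.range n) (d.modifyHead (· - 1)) +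
      numGaps (Finset.range n) (d.modifyLast (· - 1)) := by
  rw [numGaps_insert hA hM, ih A hn.le, ih A hn.le, hn]
  congr 2
  have := Finset.sum_powerset_apply_card (fun m => ∑ j ∈ Finset.range (d.length + 1),
    numGaps (Finset.range m) (d.take j) * numGaps (Finset.range (n - m)) (d.drop j)) (x := A)
  simp only [smul_eq_mul, hn] at this
  rw [← this]
  refine Finset.sum_congr rfl fun B hB => Finset.sum_congr rfl fun j _ => ?_
  rw [Finset.mem_powerset] at hB
  have h1 := Finset.card_le_card hB
  have h2 := Finset.card_sdiff_of_subset hB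
  rw [ih B (by omega), ih (A \ B) (by omega), h2, hn]

/-- The number of arrangements with a given gap list depends only on the number of letters. -/
theorem numGaps_eq_numGaps_range (A : Finset ℕ) (d : List ℕ) :
    numGaps A d = numGaps (Finset.range A.card) d := by
  induction h : A.card using Nat.strong_induction_on generalizing A d with
  | _ n ih =>
    match n, h with
    | 0, h => rw [Finset.card_eq_zero.1 h, Finset.range_zero]
    | 1, h =>
      obtain ⟨x, rfl⟩ := Finset.card_eq_one.1 h
      rw [Finset.range_one, numGaps_singleton, numGaps_singleton]
    | n + 2, h =>
      have ih' : ∀ B : Finset ℕ, B.card ≤ n + 1 → ∀ d,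
          numGaps B d = numGaps (Finset.range B.card) d :=
        fun B hB d => ih B.card (by omega) B d rfl
      have hA : A.Nonempty := Finset.card_pos.1 (by omega)
      have hMA := A.max'_mem hA
      have hc : (A.erase (A.max' hA)).card = n + 1 := by
        rw [Finset.card_erase_of_mem hMA]; omega
      rw [← Finset.insert_erase hMA, numGaps_insert_of_card_le ih' hc
        (Finset.card_pos.1 (by omega)) (fun x hx => A.lt_max'_of_mem_erase_max' hA hx),
        Finset.range_add_one (n := n + 1), numGaps_insert_of_card_le ih' (Finset.card_range _)
        (by simp) (by simp), ← Finset.range_add_one (n := n + 1)]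

/-- The proportion of the permutations of `[n]`, `n = d.sum - 1`, whose gap list is `d`. -/
noncomputable def gapProb (d : List ℕ) : ℚ :=
  numGaps (Finset.range (d.sum - 1)) d / (d.sum - 1).factorial

theorem numGaps_eq_factorial_mul (A : Finset ℕ) {d : List ℕ} (h : d.sum = A.card + 1) :
    (numGaps A d : ℚ) = A.card.factorial * gapProb d := by
  have : (A.card.factorial : ℚ) ≠ 0 := by exact_mod_cast A.card.factorial_ne_zero
  rw [gapProb, numGaps_eq_numGaps_range, h, Nat.add_sub_cancel]
  field_simp

theorem gapProb_nonneg (d : List ℕ) : 0 ≤ gapProb d := by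
  unfold gapProb; positivity

theorem gapProb_of_sum_le_one {d : List ℕ} (h : d.sum ≤ 1) : gapProb d = 0 := by
  have : d.sum - 1 = 0 := by omega
  rw [gapProb, this, Finset.range_zero, numGaps_empty]
  simp

theorem gapProb_nil : gapProb [] = 0 := gapProb_of_sum_le_one (by simp)

theorem gapProb_eq_zero {d : List ℕ} {a : ℕ} (ha : a ∈ d) (h : a < 2) : gapProb d = 0 := by
  rw [gapProb, numGaps_eq_zero_of_lt_two ha h]
  simp

theorem gapProb_two : gapProb [2] = 1 := by
  have := numGaps_singleton 0 [2]
  simp only [if_true] at this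
  simp [gapProb, this]

/-- The sum of `gapProb d' * gapProb d''` over the splittings `d = d' ++ d''`. -/
noncomputable def splitSum (d : List ℕ) : ℚ :=
  ∑ j ∈ Finset.range (d.length + 1), gapProb (d.take j) * gapProb (d.drop j)

theorem numGaps_range_eq (n : ℕ) {d : List ℕ} (h : d.sum = n + 1) :
    (numGaps (Finset.range n) d : ℚ) = n.factorial * gapProb d := by
  have := numGaps_eq_factorial_mul (Finset.range n) (d := d) (by rw [Finset.card_range]; exact h)
  rwa [Finset.card_range] at this

theorem sum_choose_mul_numGaps (n : ℕ) {d e : List ℕ} (h : d.sum + e.sum = n + 2) :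
    ∑ m ∈ Finset.range (n + 1), (n.choose m : ℚ) * (numGaps (Finset.range m) d *
      numGaps (Finset.range (n - m)) e) = n.factorial * (gapProb d * gapProb e) := by
  rcases Nat.eq_zero_or_pos d.sum with hd | hd
  · rw [gapProb_of_sum_le_one (by omega : d.sum ≤ 1), Finset.sum_eq_zero]
    · simp
    · intro m _
      rw [numGaps_eq_zero_of_sum_ne (d := d) (by rw [Finset.card_range]; omega)]
      simp
  rcases Nat.eq_zero_or_pos e.sum with he | he
  · rw [gapProb_of_sum_le_one (by omega : e.sum ≤ 1), Finset.sum_eq_zero]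
    · simp
    · intro m _
      rw [numGaps_eq_zero_of_sum_ne (d := e) (by rw [Finset.card_range]; omega)]
      simp
  obtain ⟨k, hk⟩ : ∃ k, d.sum = k + 1 := ⟨d.sum - 1, by omega⟩
  have hkn : k ≤ n := by omega
  rw [Finset.sum_eq_single_of_mem k (Finset.mem_range.2 (by omega))]
  · rw [numGaps_range_eq k hk, numGaps_range_eq (n - k) (by omega),
      ← Nat.choose_mul_factorial_mul_factorial hkn]
    push_cast
    ring
  · intro m _ hm
    rw [numGaps_eq_zero_of_sum_ne (d := d) (by rw [Finset.card_range]; omega)]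
    simp

theorem modifyHead_pred_sum {d : List ℕ} (h : ∀ a ∈ d, 1 ≤ a) (hd : d ≠ []) :
    (d.modifyHead (· - 1)).sum + 1 = d.sum := by
  rcases d with _ | ⟨a, t⟩
  · exact absurd rfl hd
  · have := h a (by simp)
    simp only [List.modifyHead_cons, List.sum_cons]; omega

theorem modifyLast_pred_sum {d : List ℕ} (h : ∀ a ∈ d, 1 ≤ a) (hd : d ≠ []) :
    (d.modifyLast (· - 1)).sum + 1 = d.sum := by
  rcases List.eq_nil_or_concat d with rfl | ⟨t, a, rfl⟩
  · exact absurd rfl hd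
  · have := h a (by simp)
    simp only [List.concat_eq_append, List.modifyLast_concat, List.sum_append, List.sum_cons,
      List.sum_nil]
    omega

theorem gapProb_take_mul_gapProb_drop_eq_zero {d : List ℕ} (h : ∃ a ∈ d, a < 2) (j : ℕ) :
    gapProb (d.take j) * gapProb (d.drop j) = 0 := by
  obtain ⟨a, ha, h2⟩ := h
  rw [← List.take_append_drop j d, List.mem_append] at ha
  rcases ha with ha | ha
  · rw [gapProb_eq_zero ha h2, zero_mul]
  · rw [gapProb_eq_zero ha h2, mul_zero]

/-- The recursion for `gapProb`, by the position of the maximal letter. -/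
theorem gapProb_rec {d : List ℕ} (h : 3 ≤ d.sum) :
    ((d.sum : ℚ) - 1) * gapProb d = splitSum d + gapProb (d.modifyHead (· - 1)) +
      gapProb (d.modifyLast (· - 1)) := by
  have hd0 : d ≠ [] := by rintro rfl; simp at h
  by_cases hd : ∃ a ∈ d, a < 2
  · have h1 : splitSum d = 0 :=
      Finset.sum_eq_zero fun j _ => gapProb_take_mul_gapProb_drop_eq_zero hd j
    obtain ⟨a, ha, h2⟩ := hd
    have h3 : gapProb (d.modifyHead (· - 1)) = 0 := by
      rcases d with _ | ⟨b, t⟩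
      · exact absurd rfl hd0
      · rw [List.modifyHead_cons]
        rcases List.mem_cons.1 ha with rfl | ha
        · exact gapProb_eq_zero (a := a - 1) (by simp) (by omega)
        · exact gapProb_eq_zero (a := a) (by simp [ha]) h2
    have h4 : gapProb (d.modifyLast (· - 1)) = 0 := by
      rcases List.eq_nil_or_concat d with rfl | ⟨t, b, rfl⟩
      · exact absurd rfl hd0
      · rw [List.concat_eq_append] at *
        rw [List.modifyLast_concat]
        rcases List.mem_append.1 ha with ha | ha
        · exact gapProb_eq_zero (a := a) (by simp [ha]) h2
        · rw [List.mem_singleton] at ha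
          exact gapProb_eq_zero (a := b - 1) (by simp) (by omega)
    rw [h1, h3, h4, gapProb_eq_zero ha h2]
    simp
  · push Not at hd
    have hd1 : ∀ a ∈ d, 1 ≤ a := fun a ha => (hd a ha).trans' (by norm_num)
    obtain ⟨n, hn⟩ : ∃ n, d.sum = n + 2 := ⟨d.sum - 2, by omega⟩
    have h1 := modifyHead_pred_sum hd1 hd0
    have h2 := modifyLast_pred_sum hd1 hd0
    have key := numGaps_insert_of_card_le (n := n) (A := Finset.range n) (M := n)
      (fun B _ d => numGaps_eq_numGaps_range B d) (Finset.card_range n)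
      (Finset.nonempty_range_iff.2 (by omega)) (by simp) d
    rw [← Finset.range_add_one] at key
    have keyQ := congrArg (Nat.cast : ℕ → ℚ) key
    push_cast at keyQ
    rw [numGaps_range_eq (n + 1) (by omega), numGaps_range_eq n (by omega),
      numGaps_range_eq n (by omega)] at keyQ
    have hs : ∑ m ∈ Finset.range (n + 1), (n.choose m : ℚ) *
        ∑ j ∈ Finset.range (d.length + 1), (numGaps (Finset.range m) (d.take j) : ℚ) *
          numGaps (Finset.range (n - m)) (d.drop j) = n.factorial * splitSum d := by
      simp only [Finset.mul_sum, splitSum]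
      rw [Finset.sum_comm]
      refine Finset.sum_congr rfl fun j _ => ?_
      refine sum_choose_mul_numGaps n ?_
      rw [List.sum_take_add_sum_drop, hn]
    rw [hs, Nat.factorial_succ] at keyQ
    have hf : (n.factorial : ℚ) ≠ 0 := by exact_mod_cast n.factorial_ne_zero
    rw [hn]
    apply mul_left_cancel₀ hf
    push_cast at keyQ ⊢
    linarith

/-! ### Cutting at a gap of three -/

/-- The splittings at or before the left side of `a`, and those at or after its right side. -/
theorem splitSum_append_cons (L : List ℕ) (a : ℕ) (R : List ℕ) :
    splitSum (L ++ a :: R) =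
      (∑ j ∈ Finset.range (L.length + 1), gapProb (L.take j) * gapProb (L.drop j ++ a :: R)) +
      ∑ i ∈ Finset.range (R.length + 1), gapProb (L ++ a :: R.take i) * gapProb (R.drop i) := by
  have hl : (L ++ a :: R).length + 1 = (L.length + 1) + (R.length + 1) := by simp; omega
  rw [splitSum, hl, Finset.sum_range_add]
  congr 1
  · refine Finset.sum_congr rfl fun j hj => ?_
    rw [Finset.mem_range] at hj
    rw [List.take_append_of_le_length (by omega), List.drop_append_of_le_length (by omega)]
  · refine Finset.sum_congr rfl fun i _ => ?_
    rw [show L.length + 1 + i = L.length + (i + 1) by omega, List.take_length_add_append,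
      List.drop_length_add_append, List.take_succ_cons, List.drop_succ_cons]

/-- The recursion at `L ++ [2]`, with the removal of a final maximal letter, which is impossible,
left out. For `L = []` the value `1` makes up for `[2]` being the initial case. -/
theorem gapProb_append_two_rec (L : List ℕ) :
    ((L.sum : ℚ) + 1) * gapProb (L ++ [2]) =
      (∑ j ∈ Finset.range (L.length + 1), gapProb (L.take j) * gapProb (L.drop j ++ [2])) +
      if L = [] then 1 else gapProb (L.modifyHead (· - 1) ++ [2]) := by
  rcases L with _ | ⟨a, t⟩
  · simp [gapProb_nil, gapProb_two]
  rcases Nat.eq_zero_or_pos (a :: t).sum with h0 | h0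
  · have ha : a = 0 := by rw [List.sum_cons] at h0; omega
    rw [if_neg (by simp), gapProb_eq_zero (a := 0) (by simp [ha]) (by norm_num),
      gapProb_eq_zero (a := 0) (by simp [ha]) (by norm_num), Finset.sum_eq_zero]
    · simp
    · intro j _
      rcases j with _ | j
      · simp [gapProb_nil]
      · rw [gapProb_eq_zero (a := 0) (by simp [ha]) (by norm_num), zero_mul]
  · have h := gapProb_rec (d := (a :: t) ++ [2]) (by
      rw [List.sum_append, List.sum_singleton]; omega)
    rw [splitSum_append_cons, List.modifyLast_concat, List.sum_append, List.sum_singleton,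
      modifyHead_append_of_ne_nil _ (by simp),
      gapProb_eq_zero (d := a :: t ++ [2 - 1]) (a := 1) (by simp) (by norm_num)] at h
    rw [if_neg (by simp)]
    simp only [List.length_nil, zero_add, Finset.range_one, Finset.sum_singleton,
      List.drop_nil, gapProb_nil, mul_zero, add_zero] at h
    push_cast at h ⊢
    linarith

/-- The mirror image of `gapProb_append_two_rec`. -/
theorem gapProb_two_cons_rec (R : List ℕ) :
    ((R.sum : ℚ) + 1) * gapProb (2 :: R) =
      (∑ i ∈ Finset.range (R.length + 1), gapProb (2 :: R.take i) * gapProb (R.drop i)) +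
      if R = [] then 1 else gapProb (2 :: R.modifyLast (· - 1)) := by
  rcases List.eq_nil_or_concat R with rfl | ⟨t, a, rfl⟩
  · simp [gapProb_nil, gapProb_two]
  rw [List.concat_eq_append]
  have hn : t ++ [a] ≠ [] := by simp
  generalize hR : t ++ [a] = R at *
  rcases Nat.eq_zero_or_pos R.sum with h0 | h0
  · have ha : a = 0 := by
      rw [← hR, List.sum_append, List.sum_singleton] at h0; omega
    have hm : (0 : ℕ) ∈ R := by rw [← hR]; simp [ha]
    have hm' : (0 : ℕ) ∈ R.modifyLast (· - 1) := by
      rw [← hR, List.modifyLast_concat]; simp [ha]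
    rw [if_neg hn, gapProb_eq_zero (a := 0) (by simp [hm]) (by norm_num),
      gapProb_eq_zero (a := 0) (by simp [hm']) (by norm_num), Finset.sum_eq_zero]
    · simp
    · intro i hi
      rw [Finset.mem_range] at hi
      rcases Nat.lt_or_ge i R.length with h | h
      · have : (0 : ℕ) ∈ R.drop i := by
          rw [← hR] at h ⊢
          rw [List.length_append, List.length_singleton] at h
          rw [List.drop_append_of_le_length (by omega)]
          simp [ha]
        rw [gapProb_eq_zero this (by norm_num), mul_zero]
      · rw [List.drop_eq_nil_of_le h, gapProb_nil, mul_zero]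
  · have h := gapProb_rec (d := 2 :: R) (by rw [List.sum_cons]; omega)
    have hs := splitSum_append_cons [] 2 R
    rw [List.nil_append] at hs
    rw [hs, List.modifyHead_cons, List.sum_cons,
      gapProb_eq_zero (d := (2 - 1) :: R) (a := 1) (by simp) (by norm_num)] at h
    have hl : (2 :: R).modifyLast (· - 1) = 2 :: R.modifyLast (· - 1) :=
      List.modifyLast_append_of_right_ne_nil _ [2] _ hn
    rw [hl] at h
    rw [if_neg hn]
    simp only [List.length_nil, zero_add, Finset.range_one, Finset.sum_singleton,
      List.take_nil, gapProb_nil, zero_mul, List.nil_append] at h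
    push_cast at h ⊢
    linarith

/-- Cutting at a gap of `3`. The two letters inside such a gap may be compared either way, so
the words on the two sides of the cut between them are independent. -/
theorem gapProb_append_three_cons (L R : List ℕ) :
    gapProb (L ++ 3 :: R) = gapProb (L ++ [2]) * gapProb (2 :: R) := by
  induction h : L.sum + R.sum using Nat.strong_induction_on generalizing L R with
  | _ n ih =>
  by_cases hL : ∃ a ∈ L, a < 2
  · obtain ⟨a, ha, h2⟩ := hL
    rw [gapProb_eq_zero (a := a) (by simp [ha]) h2,
      gapProb_eq_zero (d := L ++ [2]) (a := a) (by simp [ha]) h2, zero_mul]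
  by_cases hR : ∃ a ∈ R, a < 2
  · obtain ⟨a, ha, h2⟩ := hR
    rw [gapProb_eq_zero (a := a) (by simp [ha]) h2,
      gapProb_eq_zero (d := 2 :: R) (a := a) (by simp [ha]) h2, mul_zero]
  push Not at hL hR
  have hL1 : ∀ a ∈ L, 1 ≤ a := fun a ha => (hL a ha).trans' (by norm_num)
  have hR1 : ∀ a ∈ R, 1 ≤ a := fun a ha => (hR a ha).trans' (by norm_num)
  have hrec := gapProb_rec (d := L ++ 3 :: R) (by
    rw [List.sum_append, List.sum_cons]; omega)
  rw [splitSum_append_cons] at hrec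
  have e1 : ∑ j ∈ Finset.range (L.length + 1), gapProb (L.take j) *
      gapProb (L.drop j ++ 3 :: R) = (∑ j ∈ Finset.range (L.length + 1),
        gapProb (L.take j) * gapProb (L.drop j ++ [2])) * gapProb (2 :: R) := by
    rw [Finset.sum_mul]
    refine Finset.sum_congr rfl fun j _ => ?_
    rcases Nat.eq_zero_or_pos (L.take j).sum with h0 | h0
    · rw [gapProb_of_sum_le_one (d := L.take j) (by omega)]; simp
    · have := List.sum_take_add_sum_drop L j
      rw [ih _ (by omega) (L.drop j) R rfl, mul_assoc]
  have e2 : ∑ i ∈ Finset.range (R.length + 1), gapProb (L ++ 3 :: R.take i) *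
      gapProb (R.drop i) = gapProb (L ++ [2]) * ∑ i ∈ Finset.range (R.length + 1),
        gapProb (2 :: R.take i) * gapProb (R.drop i) := by
    rw [Finset.mul_sum]
    refine Finset.sum_congr rfl fun i _ => ?_
    rcases Nat.eq_zero_or_pos (R.drop i).sum with h0 | h0
    · rw [gapProb_of_sum_le_one (d := R.drop i) (by omega)]; simp
    · have := List.sum_take_add_sum_drop R i
      rw [ih _ (by omega) L (R.take i) rfl, mul_assoc]
  have e3 : gapProb ((L ++ 3 :: R).modifyHead (· - 1)) =
      (if L = [] then 1 else gapProb (L.modifyHead (· - 1) ++ [2])) * gapProb (2 :: R) := by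
    split_ifs with h0
    · subst h0; simp
    · have := modifyHead_pred_sum hL1 h0
      rw [modifyHead_append_of_ne_nil _ h0, ih _ (by omega) _ R rfl]
  have e4 : gapProb ((L ++ 3 :: R).modifyLast (· - 1)) = gapProb (L ++ [2]) *
      (if R = [] then 1 else gapProb (2 :: R.modifyLast (· - 1))) := by
    split_ifs with h0
    · subst h0; rw [List.modifyLast_concat, mul_one]
    · have := modifyLast_pred_sum hR1 h0
      have hl : (L ++ 3 :: R).modifyLast (· - 1) = L ++ 3 :: R.modifyLast (· - 1) := by
        have := List.modifyLast_append_of_right_ne_nil (· - 1) (L ++ [3]) R h0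
        simpa using this
      rw [hl, ih _ (by omega) L _ rfl]
  have r1 := gapProb_append_two_rec L
  have r2 := gapProb_two_cons_rec R
  rw [e1, e2, e3, e4, List.sum_append, List.sum_cons] at hrec
  simp only [Nat.cast_add, Nat.cast_ofNat] at hrec
  have hpos : (0 : ℚ) < L.sum + R.sum + 2 := by positivity
  apply mul_left_cancel₀ hpos.ne'
  linear_combination hrec - gapProb (2 :: R) * r1 - gapProb (L ++ [2]) * r2

/-! ### Values at short lists -/

theorem gapProb_three : gapProb [3] = 1 := by
  have h := gapProb_append_three_cons [] []
  simpa [gapProb_two] using h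

theorem gapProb_eq_of_rec {d : List ℕ} {x : ℚ} (h : 3 ≤ d.sum)
    (hx : splitSum d + gapProb (d.modifyHead (· - 1)) + gapProb (d.modifyLast (· - 1)) =
      ((d.sum : ℚ) - 1) * x) : gapProb d = x := by
  have h1 := gapProb_rec h
  rw [hx] at h1
  have : (3 : ℚ) ≤ d.sum := by exact_mod_cast h
  exact mul_left_cancel₀ (by linarith) h1

theorem gapProb_cons_one (a : ℕ) : gapProb [a, 1] = 0 :=
  gapProb_eq_zero (a := 1) (by simp) (by norm_num)

theorem gapProb_one_cons (t : List ℕ) : gapProb (1 :: t) = 0 :=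
  gapProb_eq_zero (a := 1) (by simp) (by norm_num)

theorem gapProb_four : gapProb [4] = 2 / 3 := by
  apply gapProb_eq_of_rec (by simp)
  norm_num [splitSum, Finset.sum_range_succ, List.modifyLast, List.modifyLast.go, gapProb_nil,
    gapProb_three]

theorem gapProb_five : gapProb [5] = 1 / 3 := by
  apply gapProb_eq_of_rec (by simp)
  norm_num [splitSum, Finset.sum_range_succ, List.modifyLast, List.modifyLast.go, gapProb_nil,
    gapProb_four]

theorem gapProb_six : gapProb [6] = 2 / 15 := by
  apply gapProb_eq_of_rec (by simp)
  norm_num [splitSum, Finset.sum_range_succ, List.modifyLast, List.modifyLast.go, gapProb_nil,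
    gapProb_five]

theorem gapProb_two_two : gapProb [2, 2] = 1 / 3 := by
  apply gapProb_eq_of_rec (by simp)
  norm_num [splitSum, Finset.sum_range_succ, List.modifyLast, List.modifyLast.go, gapProb_nil,
    gapProb_two, gapProb_cons_one, gapProb_one_cons]

theorem gapProb_two_two_two : gapProb [2, 2, 2] = 2 / 15 := by
  apply gapProb_eq_of_rec (by simp)
  rw [gapProb_eq_zero (d := [2, 2, 2].modifyLast (· - 1)) (a := 1) (by decide) (by norm_num)]
  norm_num [splitSum, Finset.sum_range_succ, gapProb_nil,
    gapProb_two, gapProb_two_two, gapProb_one_cons]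

theorem gapProb_four_two : gapProb [4, 2] = 1 / 5 := by
  have h := gapProb_append_three_cons [] [2]
  rw [List.nil_append, List.nil_append, gapProb_two, gapProb_two_two] at h
  apply gapProb_eq_of_rec (by simp)
  norm_num [splitSum, Finset.sum_range_succ, List.modifyLast, List.modifyLast.go, gapProb_nil,
    gapProb_two, gapProb_cons_one, gapProb_four, h]

theorem gapProb_two_four : gapProb [2, 4] = 1 / 5 := by
  have h := gapProb_append_three_cons [2] []
  simp only [List.singleton_append, gapProb_two, gapProb_two_two] at h
  apply gapProb_eq_of_rec (by simp)
  norm_num [splitSum, Finset.sum_range_succ, List.modifyLast, List.modifyLast.go, gapProb_nil,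
    gapProb_two, gapProb_one_cons, gapProb_four, h]

theorem gapProb_five_two : gapProb [5, 2] = 4 / 45 := by
  apply gapProb_eq_of_rec (by simp)
  norm_num [splitSum, Finset.sum_range_succ, List.modifyLast, List.modifyLast.go, gapProb_nil,
    gapProb_two, gapProb_cons_one, gapProb_five, gapProb_four_two]

theorem gapProb_two_five : gapProb [2, 5] = 4 / 45 := by
  apply gapProb_eq_of_rec (by simp)
  norm_num [splitSum, Finset.sum_range_succ, List.modifyLast, List.modifyLast.go, gapProb_nil,
    gapProb_two, gapProb_one_cons, gapProb_five, gapProb_two_four]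

/-! ### Decay without gaps of three -/

/-- The factor that an outer gap `a` contributes to the bound `gapProb_le`. The constants are chosen
so that `weight a ^ 2 ≤ 49 / 64 * a` for `a = 2` and `a ≥ 4`, which makes the junctions cost less
than `1` per unit of the sum, and so that the bound holds for all lists of sum at most `6` without
a `3`. Together with the rate `27 / 40`, they are small enough for longer lists without a `3` to
fall strictly below the optimum. -/
def weight (a : ℕ) : ℚ := if a = 2 then 121 / 100 else 7 / 4

/-- The correction to geometric decay for gap lists of sum `s`. It is needed for `[2]`, and for
`[4]` and `[2, 2]`. -/
def corr (s : ℕ) : ℚ := if s = 2 then 3 / 2 else if s = 4 then 11 / 10 else 1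

/-- An allowance for the last gap `z` in the estimate of `junctionSum`. -/
def lastCost (z : ℕ) : ℚ := if z = 2 then 3 / 25 else -49 / 40

/-- Bounds the end term of the recursion at an outer gap `z`. -/
def decCost (z : ℕ) : ℚ := if z = 2 then 0 else 38 / 25

/-- The normalized contribution of the junctions that follow the gap `a` in a gap list, where the
gaps up to and including `a` have sum `s`, and `t` lists the later gaps. A junction between `a` and
`b` contributes the product of the bounds for the two sides, divided by the outer weights and by
the power of `27 / 40`. -/
def junctionSum : ℕ → ℕ → List ℕ → ℚ
  | _, _, [] => 0
  | s, a, b :: t => weight a * weight b * corr s * corr (b :: t).sum + junctionSum (s + b) b t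

theorem weight_two : weight 2 = 121 / 100 := rfl

theorem weight_of_four_le {a : ℕ} (h : 4 ≤ a) : weight a = 7 / 4 := if_neg (by omega)

theorem weight_pos (a : ℕ) : 0 < weight a := by
  unfold weight; split_ifs <;> norm_num

theorem corr_pos (a : ℕ) : 0 < corr a := by
  unfold corr; split_ifs <;> norm_num

theorem corr_of_five_le {s : ℕ} (h : 5 ≤ s) : corr s = 1 := by
  unfold corr; rw [if_neg (by omega), if_neg (by omega)]

theorem corr_le_of_three_le {s : ℕ} (h : 3 ≤ s) : corr s ≤ 11 / 10 := by
  unfold corr; rw [if_neg (by omega)]; split_ifs <;> norm_num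

theorem weight_sq_le {a : ℕ} (h : a = 2 ∨ 4 ≤ a) : weight a ^ 2 ≤ 49 / 64 * a := by
  rcases h with rfl | h
  · norm_num [weight_two]
  · have : (4 : ℚ) ≤ a := by exact_mod_cast h
    rw [weight_of_four_le h]; linarith

theorem lastCost_add_decCost_le (z : ℕ) : lastCost z + decCost z ≤ 3 / 10 := by
  unfold lastCost decCost; split_ifs <;> norm_num

theorem two_le_sum_of_ne_nil {t : List ℕ} (ht : t ≠ []) (h : ∀ x ∈ t, x = 2 ∨ 4 ≤ x) :
    2 ≤ t.sum := by
  obtain ⟨b, t, rfl⟩ := List.exists_cons_of_ne_nil ht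
  have := h b (by simp)
  rw [List.sum_cons]; omega

/-- Past the short prefixes, a junction costs at most the mean of the squared weights of its two
gaps, hence at most `49 / 64` per unit of the sum; `lastCost` absorbs the short suffixes. -/
theorem junctionSum_le : ∀ {t : List ℕ} {s a : ℕ}, 5 ≤ s → t ≠ [] → (a = 2 ∨ 4 ≤ a) →
    (∀ x ∈ t, x = 2 ∨ 4 ≤ x) →
    junctionSum s a t ≤ weight a ^ 2 / 2 + 49 / 64 * t.sum + lastCost (t.getLastD a)
  | [], _, _, _, h, _, _ => absurd rfl h
  | [b], s, a, hs, _, ha, ht => by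
    have hb := ht b (by simp)
    have hw : weight a = 121 / 100 ∨ weight a = 7 / 4 := by
      rcases ha with rfl | ha
      · exact Or.inl rfl
      · exact Or.inr (weight_of_four_le ha)
    simp only [junctionSum, List.sum_singleton, List.getLastD_cons, List.getLastD_nil,
      corr_of_five_le hs, add_zero, mul_one]
    rcases hb with rfl | hb
    · rcases hw with hw | hw <;> norm_num [hw, weight_two, corr, lastCost]
    · have h4 : (4 : ℚ) ≤ b := by exact_mod_cast hb
      have hc := corr_le_of_three_le (s := b) (by omega)
      have hl : lastCost b = -49 / 40 := if_neg (by omega)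
      rw [weight_of_four_le hb, hl]
      rcases hw with hw | hw <;> rw [hw] <;> linarith
  | b :: c :: t, s, a, hs, _, ha, ht => by
    have hb := ht b (by simp)
    have hc := ht c (by simp)
    have ih := junctionSum_le (t := c :: t) (s := s + b) (a := b) (by omega) (by simp) hb
      (fun x hx => ht x (by simp at hx ⊢; tauto))
    have hw := weight_sq_le hb
    rw [junctionSum, List.getLastD_cons, List.sum_cons, corr_of_five_le hs]
    push_cast [-Nat.cast_list_sum]
    rcases Nat.lt_or_ge (b + (c :: t).sum) 5 with h5 | h5
    · -- `[2, 2]` is the only list with two parts or more and sum below `5`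
      rw [List.sum_cons] at h5
      obtain rfl : b = 2 := by omega
      obtain rfl : c = 2 := by omega
      have ht0 : t = [] := by
        by_contra h0
        have := two_le_sum_of_ne_nil h0 (fun x hx => ht x (by simp [hx]))
        omega
      subst ht0
      have hwa : weight a = 121 / 100 ∨ weight a = 7 / 4 := by
        rcases ha with rfl | ha
        · exact Or.inl rfl
        · exact Or.inr (weight_of_four_le ha)
      simp only [junctionSum, corr_of_five_le (show 5 ≤ s + 2 by omega)]
      rcases hwa with hwa | hwa <;> norm_num [hwa, weight_two, corr, lastCost]
    · rw [corr_of_five_le h5]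
      nlinarith [sq_nonneg (weight a - weight b)]

/-- The junctions and the two end terms of the recursion together stay below `d.sum - 1`. -/
theorem junctionSum_add_decCost_le {f : ℕ} {t : List ℕ} (ht0 : t ≠ []) (hf : f = 2 ∨ 4 ≤ f)
    (ht : ∀ x ∈ t, x = 2 ∨ 4 ≤ x) (hN : 7 ≤ f + t.sum) :
    junctionSum f f t + decCost f + decCost (t.getLastD f) ≤ (f : ℚ) + t.sum - 1 := by
  obtain ⟨b, t, rfl⟩ := List.exists_cons_of_ne_nil ht0
  have hb := ht b (by simp)
  have ht' : ∀ x ∈ t, x = 2 ∨ 4 ≤ x := fun x hx => ht x (by simp [hx])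
  have hNQ : (7 : ℚ) ≤ (f : ℚ) + ((b :: t).sum : ℕ) := by exact_mod_cast hN
  have hz := lastCost_add_decCost_le ((b :: t).getLastD f)
  rw [List.sum_cons] at hN
  by_cases hf5 : 5 ≤ f
  · have h1 := junctionSum_le (s := f) (a := f) hf5 ht0 hf ht
    have hd : decCost f = 38 / 25 := if_neg (by omega)
    have hfQ : (5 : ℚ) ≤ f := by exact_mod_cast hf5
    rw [weight_of_four_le (by omega)] at h1
    rw [hd]
    linarith
  rw [List.getLastD_cons] at hz ⊢
  rw [junctionSum, List.sum_cons]
  rw [List.sum_cons] at hNQ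
  push_cast [-Nat.cast_list_sum] at hNQ ⊢
  obtain rfl | rfl : f = 2 ∨ f = 4 := by omega
  · have hd : decCost 2 = 0 := rfl
    rw [corr_of_five_le (s := b + t.sum) (by omega), hd, weight_two, show corr 2 = 3 / 2 from rfl]
    rcases hb with rfl | hb
    · -- two leading gaps of `2`: the second junction is still corrected
      rcases t with _ | ⟨c, t⟩
      · simp at hN
      have hc := ht' c (by simp)
      rw [List.sum_cons] at hN
      have hcor := corr_le_of_three_le (s := (c :: t).sum) (by rw [List.sum_cons]; omega)
      rw [List.getLastD_cons] at hz ⊢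
      rw [junctionSum, show corr (2 + 2) = 11 / 10 from rfl, weight_two]
      rw [List.sum_cons] at hcor hNQ ⊢
      push_cast [-Nat.cast_list_sum] at hNQ ⊢
      have hcp := corr_pos (c + t.sum)
      rcases t with _ | ⟨x, t⟩
      · have hc4 : 4 ≤ c := by simp at hN; omega
        have hc4Q : (4 : ℚ) ≤ c := by exact_mod_cast hc4
        have hdz : decCost c = 38 / 25 := if_neg (by omega)
        rw [List.getLastD_nil, weight_of_four_le hc4, junctionSum, hdz]
        simp only [List.sum_nil, add_zero, Nat.cast_zero] at *
        linarith
      · have h1 := junctionSum_le (t := x :: t) (s := 2 + 2 + c) (a := c) (by omega) (by simp) hc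
          (fun y hy => ht' y (by simp at hy ⊢; tauto))
        rcases hc with rfl | hc
        · rw [weight_two] at h1 ⊢
          push_cast [-Nat.cast_list_sum] at hNQ ⊢
          linarith
        · have hcQ : (4 : ℚ) ≤ c := by exact_mod_cast hc
          rw [weight_of_four_le hc] at h1 ⊢
          linarith
    · have h4 : (4 : ℚ) ≤ b := by exact_mod_cast hb
      rw [weight_of_four_le hb]
      rcases t with _ | ⟨x, t⟩
      · have hdz : decCost b = 38 / 25 := if_neg (by omega)
        rw [List.getLastD_nil, junctionSum, hdz]
        simp only [List.sum_nil] at *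
        norm_num
        linarith
      · have h1 := junctionSum_le (t := x :: t) (s := 2 + b) (a := b) (by omega) (by simp)
          (Or.inr hb) ht'
        rw [weight_of_four_le hb] at h1
        push_cast [-Nat.cast_list_sum] at *
        linarith
  · have hd : decCost 4 = 38 / 25 := rfl
    have hcor := corr_le_of_three_le (s := b + t.sum) (by omega)
    have hcp := corr_pos (b + t.sum)
    rw [hd, weight_of_four_le le_rfl, show corr 4 = 11 / 10 from rfl]
    rcases hb with rfl | hb
    · rcases t with _ | ⟨x, t⟩
      · simp at hN
      · have h1 := junctionSum_le (t := x :: t) (s := 4 + 2) (a := 2) (by omega) (by simp)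
          (Or.inl rfl) ht'
        rw [weight_two] at h1 ⊢
        push_cast [-Nat.cast_list_sum] at *
        linarith
    · have h4 : (4 : ℚ) ≤ b := by exact_mod_cast hb
      rw [weight_of_four_le hb]
      rcases t with _ | ⟨x, t⟩
      · have hdz : decCost b = 38 / 25 := if_neg (by omega)
        rw [List.getLastD_nil, junctionSum, hdz]
        simp only [List.sum_nil, add_zero] at *
        norm_num
        linarith
      · have h1 := junctionSum_le (t := x :: t) (s := 4 + b) (a := b) (by omega) (by simp)
          (Or.inr hb) ht'
        have h2 := two_le_sum_of_ne_nil (t := x :: t) (by simp) ht'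
        have h2Q : (2 : ℚ) ≤ ((x :: t).sum : ℕ) := by exact_mod_cast h2
        rw [weight_of_four_le hb] at h1
        push_cast [-Nat.cast_list_sum] at *
        linarith

theorem weight_le (a : ℕ) : weight a ≤ 7 / 4 := by
  unfold weight; split_ifs <;> norm_num

/-- The splittings at the junctions to the right of `f :: u`, given the bound for lists of sum
below `n`. -/
theorem sum_splits_le {n : ℕ}
    (ih : ∀ (a : ℕ) (t : List ℕ), (∀ x ∈ a :: t, x = 2 ∨ 4 ≤ x) → (a :: t).sum < n →
      gapProb (a :: t) ≤ weight a * weight (t.getLastD a) * corr (a :: t).sum *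
        (27 / 40) ^ (a :: t).sum) (f : ℕ) :
    ∀ (t u : List ℕ), (∀ x ∈ f :: (u ++ t), x = 2 ∨ 4 ≤ x) → (f :: (u ++ t)).sum ≤ n →
      ∑ i ∈ Finset.range (t.length + 1), gapProb (f :: (u ++ t.take i)) * gapProb (t.drop i) ≤
        weight f * weight (t.getLastD (u.getLastD f)) * (27 / 40) ^ (f :: (u ++ t)).sum *
          junctionSum (f + u.sum) (u.getLastD f) t
  | [], u, _, _ => by simp [junctionSum, gapProb_nil]
  | b :: t, u, h, hn => by
    have ih2 := sum_splits_le ih f t (u ++ [b]) (by simpa using h) (by simpa using hn)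
    rw [List.length_cons, Finset.sum_range_succ']
    simp only [List.take_succ_cons, List.drop_succ_cons, List.take_zero, List.drop_zero,
      List.append_nil]
    simp only [List.append_assoc, List.singleton_append] at ih2
    have hl : (u ++ [b]).getLastD f = b := by simp [List.getLastD_eq_getLast?]
    have hsum : (u ++ [b]).sum = u.sum + b := by simp
    rw [hl, hsum, ← add_assoc] at ih2
    have hf := h f (by simp)
    have hb := h b (by simp)
    have hs : (f :: (u ++ b :: t)).sum = (f :: u).sum + (b :: t).sum := by
      simp only [List.sum_cons, List.sum_append]; omega
    have hsf : (f :: u).sum = f + u.sum := by simp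
    have hsb : (b :: t).sum = b + t.sum := by simp
    have h1 := ih f u (fun x hx => h x (by simp at hx ⊢; tauto)) (by omega)
    have h2 := ih b t (fun x hx => h x (by simp at hx ⊢; tauto)) (by omega)
    have h3 := mul_le_mul h1 h2 (gapProb_nonneg _) (by
      have := weight_pos f
      have := weight_pos (u.getLastD f)
      have := corr_pos (f :: u).sum
      positivity)
    rw [junctionSum, List.getLastD_cons, mul_add]
    refine (add_le_add ih2 h3).trans (le_of_eq ?_)
    rw [hs, pow_add, hsf]
    ring

/-- The end term of the recursion at the first gap, given the bound for lists of sum below `n`.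
A first gap `4` becomes a `3`, which is removed by a cut. -/
theorem gapProb_pred_cons_le {n : ℕ}
    (ih : ∀ (a : ℕ) (t : List ℕ), (∀ x ∈ a :: t, x = 2 ∨ 4 ≤ x) → (a :: t).sum < n →
      gapProb (a :: t) ≤ weight a * weight (t.getLastD a) * corr (a :: t).sum *
        (27 / 40) ^ (a :: t).sum) {a : ℕ} {t : List ℕ} (ht : t ≠ [])
    (h : ∀ x ∈ a :: t, x = 2 ∨ 4 ≤ x) (hn : (a :: t).sum = n) (h7 : 7 ≤ n) :
    gapProb ((a - 1) :: t) ≤ weight a * weight (t.getLastD a) * (27 / 40) ^ n * decCost a := by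
  obtain ⟨b, s, rfl⟩ := List.exists_cons_of_ne_nil ht
  rw [List.getLastD_cons]
  rw [List.sum_cons] at hn
  have hw := weight_pos (s.getLastD b)
  rcases h a (by simp) with rfl | ha
  · rw [gapProb_one_cons, show decCost 2 = 0 from rfl, mul_zero]
  · have hd : decCost a = 38 / 25 := if_neg (by omega)
    rw [hd, weight_of_four_le ha]
    rcases Nat.lt_or_ge 4 a with ha5 | ha5
    · have h1 := ih (a - 1) (b :: s) (by
        intro x hx
        rcases List.mem_cons.1 hx with rfl | hx
        · right; omega
        · exact h x (by simp [hx])) (by rw [List.sum_cons]; omega)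
      rw [List.sum_cons, show a - 1 + (b :: s).sum = n - 1 by omega, corr_of_five_le (by omega),
        weight_of_four_le (by omega), List.getLastD_cons] at h1
      have hp : ((27 : ℚ) / 40) ^ n = (27 / 40) ^ (n - 1) * (27 / 40) := by
        rw [← pow_succ]; congr 1; omega
      have : 0 < weight (s.getLastD b) * (27 / 40) ^ (n - 1) := by positivity
      rw [hp]
      linarith
    · obtain rfl : a = 4 := by omega
      have hc := gapProb_append_three_cons [] (b :: s)
      rw [List.nil_append, List.nil_append, gapProb_two, one_mul] at hc
      have h1 := ih 2 (b :: s) (by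
        intro x hx
        rcases List.mem_cons.1 hx with rfl | hx
        · left; rfl
        · exact h x (by simp [hx])) (by rw [List.sum_cons]; omega)
      rw [List.sum_cons, show 2 + (b :: s).sum = n - 2 by omega, corr_of_five_le (by omega),
        weight_two, List.getLastD_cons] at h1
      have hp : ((27 : ℚ) / 40) ^ n = (27 / 40) ^ (n - 2) * (27 / 40) ^ 2 := by
        rw [← pow_add]; congr 1; omega
      have : 0 < weight (s.getLastD b) * (27 / 40) ^ (n - 2) := by positivity
      rw [hp, show 4 - 1 = 3 from rfl, hc]
      linarith

/-- The end term of the recursion at the last gap, given the bound for lists of sum below `n`. -/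
theorem gapProb_append_pred_le {n : ℕ}
    (ih : ∀ (a : ℕ) (t : List ℕ), (∀ x ∈ a :: t, x = 2 ∨ 4 ≤ x) → (a :: t).sum < n →
      gapProb (a :: t) ≤ weight a * weight (t.getLastD a) * corr (a :: t).sum *
        (27 / 40) ^ (a :: t).sum) {a z : ℕ} {t : List ℕ}
    (h : ∀ x ∈ a :: (t ++ [z]), x = 2 ∨ 4 ≤ x) (hn : (a :: (t ++ [z])).sum = n) (h7 : 7 ≤ n) :
    gapProb (a :: (t ++ [z - 1])) ≤ weight a * weight z * (27 / 40) ^ n * decCost z := by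
  have hl : ∀ y, (t ++ [y]).getLastD a = y := fun y => by simp [List.getLastD_eq_getLast?]
  have hs : ∀ y, (a :: (t ++ [y])).sum = (a + t.sum) + y := fun y => by
    rw [List.sum_cons, List.sum_append, List.sum_singleton, add_assoc]
  rw [hs] at hn
  have hw := weight_pos a
  rcases h z (by simp) with rfl | hz
  · rw [gapProb_eq_zero (a := 1) (by simp) (by norm_num), show decCost 2 = 0 from rfl, mul_zero]
  · have hd : decCost z = 38 / 25 := if_neg (by omega)
    rw [hd, weight_of_four_le hz]
    rcases Nat.lt_or_ge 4 z with hz5 | hz5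
    · have h1 := ih a (t ++ [z - 1]) (by
        intro x hx
        rw [List.mem_cons, List.mem_append, List.mem_singleton] at hx
        rcases hx with rfl | hx | rfl
        · exact h x (by simp)
        · exact h x (by simp [hx])
        · right; omega) (by rw [hs]; omega)
      rw [hs, show a + t.sum + (z - 1) = n - 1 by omega, corr_of_five_le (by omega), hl,
        weight_of_four_le (a := z - 1) (by omega)] at h1
      have hp : ((27 : ℚ) / 40) ^ n = (27 / 40) ^ (n - 1) * (27 / 40) := by
        rw [← pow_succ]; congr 1; omega
      have : 0 < weight a * (27 / 40) ^ (n - 1) := by positivity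
      rw [hp]
      linarith
    · obtain rfl : z = 4 := by omega
      have hc := gapProb_append_three_cons (a :: t) []
      rw [gapProb_two, mul_one, List.cons_append, List.cons_append] at hc
      have h1 := ih a (t ++ [2]) (by
        intro x hx
        rw [List.mem_cons, List.mem_append, List.mem_singleton] at hx
        rcases hx with rfl | hx | rfl
        · exact h x (by simp)
        · exact h x (by simp [hx])
        · left; rfl) (by rw [hs]; omega)
      rw [hs, show a + t.sum + 2 = n - 2 by omega, corr_of_five_le (by omega), hl,
        weight_two] at h1
      have hp : ((27 : ℚ) / 40) ^ n = (27 / 40) ^ (n - 2) * (27 / 40) ^ 2 := by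
        rw [← pow_add]; congr 1; omega
      have : 0 < weight a * (27 / 40) ^ (n - 2) := by positivity
      rw [hp, show 4 - 1 = 3 from rfl, hc]
      linarith

theorem gapProb_le_of_sum_le_six {a : ℕ} {t : List ℕ} (h : ∀ x ∈ a :: t, x = 2 ∨ 4 ≤ x)
    (hn : (a :: t).sum ≤ 6) :
    gapProb (a :: t) ≤ weight a * weight (t.getLastD a) * corr (a :: t).sum *
      (27 / 40) ^ (a :: t).sum := by
  have ha := h a (by simp)
  rcases t with _ | ⟨b, t⟩
  · rw [List.sum_singleton] at hn
    obtain rfl | rfl | rfl | rfl : a = 2 ∨ a = 4 ∨ a = 5 ∨ a = 6 := by omega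
    · norm_num [gapProb_two, weight, corr]
    · norm_num [gapProb_four, weight, corr]
    · norm_num [gapProb_five, weight, corr]
    · norm_num [gapProb_six, weight, corr]
  have hb := h b (by simp)
  rw [List.sum_cons, List.sum_cons] at hn
  rcases t with _ | ⟨c, t⟩
  · rw [List.sum_nil] at hn
    obtain ⟨rfl, rfl⟩ | ⟨rfl, rfl⟩ | ⟨rfl, rfl⟩ : a = 2 ∧ b = 2 ∨ a = 2 ∧ b = 4 ∨ a = 4 ∧ b = 2 := by
      omega
    · norm_num [gapProb_two_two, weight, corr]
    · norm_num [gapProb_two_four, weight, corr]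
    · norm_num [gapProb_four_two, weight, corr]
  have hc := h c (by simp)
  rw [List.sum_cons] at hn
  obtain rfl : a = 2 := by omega
  obtain rfl : b = 2 := by omega
  obtain rfl : c = 2 := by omega
  obtain rfl : t = [] := by
    by_contra h0
    have := two_le_sum_of_ne_nil h0 (fun x hx => h x (by simp [hx]))
    omega
  norm_num [gapProb_two_two_two, weight, corr]

/-- Gap lists without a gap of `3` have probability decaying like `(27 / 40) ^ d.sum`. -/
theorem gapProb_le (a : ℕ) (t : List ℕ) (h : ∀ x ∈ a :: t, x = 2 ∨ 4 ≤ x) :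
    gapProb (a :: t) ≤ weight a * weight (t.getLastD a) * corr (a :: t).sum *
      (27 / 40) ^ (a :: t).sum := by
  induction hn : (a :: t).sum using Nat.strong_induction_on generalizing a t with
  | _ n ih =>
  rcases Nat.lt_or_ge n 7 with h7 | h7
  · subst hn
    exact gapProb_le_of_sum_le_six h (by omega)
  have ih' : ∀ (a : ℕ) (t : List ℕ), (∀ x ∈ a :: t, x = 2 ∨ 4 ≤ x) → (a :: t).sum < n →
      gapProb (a :: t) ≤ weight a * weight (t.getLastD a) * corr (a :: t).sum *
        (27 / 40) ^ (a :: t).sum := fun a t h hlt => ih _ hlt a t h rfl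
  have hnQ : (7 : ℚ) ≤ n := by exact_mod_cast h7
  rw [corr_of_five_le (by omega), mul_one]
  have hrec := gapProb_rec (d := a :: t) (by omega)
  have hs := splitSum_append_cons [] a t
  simp only [List.nil_append, List.length_nil, zero_add, Finset.range_one, Finset.sum_singleton,
    List.take_nil, gapProb_nil, zero_mul] at hs
  have hsplit := sum_splits_le ih' a t [] h hn.le
  simp only [List.nil_append, List.sum_nil, add_zero, List.getLastD_nil, hn] at hsplit
  rw [hs, hn, List.modifyHead_cons] at hrec
  have hpos : (0 : ℚ) < (n : ℚ) - 1 := by linarith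
  refine le_of_mul_le_mul_left ?_ hpos
  rw [hrec]
  rcases List.eq_nil_or_concat t with rfl | ⟨s, z, rfl⟩
  · rw [List.sum_singleton] at hn
    subst hn
    have h1 := ih' (a - 1) [] (by simp; omega) (by simp; omega)
    have hm : [a].modifyLast (· - 1) = [a - 1] := rfl
    rw [List.sum_singleton, List.getLastD_nil, corr_of_five_le (by omega),
      weight_of_four_le (by omega)] at h1
    rw [hm, List.getLastD_nil, weight_of_four_le (by omega)]
    simp only [junctionSum, mul_zero] at hsplit
    have hp : ((27 : ℚ) / 40) ^ a = (27 / 40) ^ (a - 1) * (27 / 40) := by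
      rw [← pow_succ]; congr 1; omega
    have : (0 : ℚ) < (27 / 40) ^ (a - 1) := by positivity
    rw [hp]
    nlinarith
  · rw [List.concat_eq_append] at *
    have hne : s ++ [z] ≠ [] := by simp
    have hl : (s ++ [z]).getLastD a = z := by simp [List.getLastD_eq_getLast?]
    have h1 := gapProb_pred_cons_le ih' hne h hn h7
    have h2 := gapProb_append_pred_le ih' h hn h7
    have h3 := junctionSum_add_decCost_le hne (h a (by simp))
      (fun x hx => h x (by simp at hx ⊢; tauto)) (by rw [List.sum_cons] at hn; omega)
    have hm : (a :: (s ++ [z])).modifyLast (· - 1) = a :: (s ++ [z - 1]) := by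
      rw [← List.cons_append, List.modifyLast_concat, List.cons_append]
    have hnn : (n : ℚ) = a + (s ++ [z]).sum := by
      rw [← hn, List.sum_cons, Nat.cast_add]
    rw [hl] at h1 h3 hsplit
    rw [hm, hl, hnn]
    have hw : 0 < weight a * weight z * (27 / 40) ^ n := by
      have := weight_pos a
      have := weight_pos z
      positivity
    have h4 := mul_le_mul_of_nonneg_left h3 hw.le
    rw [← hnn] at h4 ⊢
    linarith

/-! ### The optimum -/

/-- The maximum of `gapProb (2 :: D)` over the lists `D` of sum `m`, for `m ≥ 3`: it is
`3 ^ (-q)`, `3 ^ (-q) * 3 / 5` or `3 ^ (-q) * 2 / 5` for `m = 3 * q`, `3 * q + 1`, `3 * q + 2`. -/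
def optFactor (m : ℕ) : ℚ :=
  (1 / 3) ^ (m / 3) * if m % 3 = 0 then 1 else if m % 3 = 1 then 3 / 5 else 2 / 5

theorem optFactor_pos (m : ℕ) : 0 < optFactor m := by
  unfold optFactor; split_ifs <;> positivity

theorem optFactor_add_three (m : ℕ) : optFactor (m + 3) = optFactor m / 3 := by
  unfold optFactor
  rw [Nat.add_div_right _ (by norm_num), Nat.add_mod_right, pow_succ]
  ring

theorem optFactor_add_three_mul (m q : ℕ) : optFactor (m + 3 * q) = (1 / 3) ^ q * optFactor m := by
  induction q with
  | zero => simp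
  | succ q ih => rw [mul_add, mul_one, ← add_assoc, optFactor_add_three, ih, pow_succ]; ring

theorem optFactor_mul_of_mod_eq_zero {a b : ℕ} (h : a % 3 = 0 ∨ b % 3 = 0) :
    optFactor a * optFactor b = optFactor (a + b) := by
  have h0 : ∀ q, optFactor (3 * q) = (1 / 3) ^ q := fun q => by
    have := optFactor_add_three_mul 0 q
    rw [zero_add] at this
    rw [this]; norm_num [optFactor]
  rcases h with h | h
  · obtain ⟨q, rfl⟩ := Nat.dvd_of_mod_eq_zero h
    rw [add_comm, optFactor_add_three_mul, h0]
  · obtain ⟨q, rfl⟩ := Nat.dvd_of_mod_eq_zero h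
    rw [optFactor_add_three_mul, h0, mul_comm]

theorem optFactor_mul_lt {a b : ℕ} (ha : a % 3 ≠ 0) (hb : b % 3 ≠ 0) :
    optFactor a * optFactor b < optFactor (a + b) := by
  have key : ∀ r s, (r = 1 ∨ r = 2) → (s = 1 ∨ s = 2) →
      optFactor r * optFactor s < optFactor (r + s) := by
    rintro r s (rfl | rfl) (rfl | rfl) <;> norm_num [optFactor]
  have h := key (a % 3) (b % 3) (by omega) (by omega)
  have e1 := optFactor_add_three_mul (a % 3) (a / 3)
  have e2 := optFactor_add_three_mul (b % 3) (b / 3)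
  have e3 := optFactor_add_three_mul (a % 3 + b % 3) (a / 3 + b / 3)
  rw [Nat.mod_add_div] at e1 e2
  rw [show a % 3 + b % 3 + 3 * (a / 3 + b / 3) = a + b by omega, pow_add] at e3
  rw [e1, e2, e3]
  have : (0 : ℚ) < (1 / 3) ^ (a / 3) * (1 / 3) ^ (b / 3) := by positivity
  calc _ = (1 / 3 : ℚ) ^ (a / 3) * (1 / 3) ^ (b / 3) *
        (optFactor (a % 3) * optFactor (b % 3)) := by ring
    _ < _ := mul_lt_mul_of_pos_left h this

theorem mul_le_optFactor_add {a b : ℕ} {x y : ℚ} (hy0 : 0 ≤ y)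
    (hx : x ≤ optFactor a) (hy : y ≤ optFactor b) :
    x * y ≤ optFactor (a + b) ∧ (x * y = optFactor (a + b) →
      x = optFactor a ∧ y = optFactor b ∧ (a % 3 = 0 ∨ b % 3 = 0)) := by
  have ha := optFactor_pos a
  have hb := optFactor_pos b
  have h1 : x * y ≤ optFactor a * optFactor b := mul_le_mul hx hy hy0 ha.le
  have h2 : optFactor a * optFactor b ≤ optFactor (a + b) := by
    by_cases h : a % 3 = 0 ∨ b % 3 = 0
    · exact (optFactor_mul_of_mod_eq_zero h).le
    · push Not at h
      exact (optFactor_mul_lt h.1 h.2).le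
  refine ⟨h1.trans h2, fun h => ?_⟩
  have h3 : x * y = optFactor a * optFactor b := le_antisymm h1 (h2.trans h.ge)
  have h4 : x = optFactor a := by
    by_contra hne
    have hlt : x < optFactor a := lt_of_le_of_ne hx hne
    rcases hy0.eq_or_lt with h0 | h0
    · rw [← h0, mul_zero] at h3
      exact absurd h3 (mul_pos ha hb).ne
    · exact absurd h3 (mul_lt_mul hlt hy h0 ha.le).ne
  refine ⟨h4, ?_, ?_⟩
  · rw [h4] at h3
    exact mul_left_cancel₀ ha.ne' h3
  · by_contra hmod
    push Not at hmod
    have := optFactor_mul_lt hmod.1 hmod.2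
    rw [← h3, h] at this
    exact lt_irrefl _ this

/-- Since `(27 / 40) ^ 3 < 1 / 3`, a comparison with `optFactor` need only be checked at three
consecutive places. -/
theorem mul_pow_lt_optFactor {c : ℚ} {k : ℕ} (hc : 0 < c)
    (h0 : c * (27 / 40) ^ k < optFactor k)
    (h1 : c * (27 / 40) ^ (k + 1) < optFactor (k + 1))
    (h2 : c * (27 / 40) ^ (k + 2) < optFactor (k + 2)) {m : ℕ} (hm : k ≤ m) :
    c * (27 / 40) ^ m < optFactor m := by
  induction m using Nat.strong_induction_on with
  | _ m ih =>
  by_cases hk : m < k + 3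
  · obtain rfl | rfl | rfl : m = k ∨ m = k + 1 ∨ m = k + 2 := by omega
    exacts [h0, h1, h2]
  · obtain ⟨j, rfl⟩ : ∃ j, m = j + 3 := ⟨m - 3, by omega⟩
    have := ih j (by omega) (by omega)
    rw [optFactor_add_three, pow_add]
    have hp : 0 < c * (27 / 40) ^ j := by positivity
    linarith

theorem getLastD_append_singleton (t : List ℕ) (x d : ℕ) : (t ++ [x]).getLastD d = x := by
  simp [List.getLastD_eq_getLast?]

/-- A piece without `3` between two gaps of `3`, which have been cut down to `2`. -/
theorem gapProb_two_cons_append_two_le {X : List ℕ} (h : ∀ x ∈ X, x = 2 ∨ 4 ≤ x) :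
    3 * gapProb (2 :: (X ++ [2])) ≤ optFactor X.sum ∧
      (3 * gapProb (2 :: (X ++ [2])) = optFactor X.sum → X = [] ∨ X = [2]) := by
  by_cases h0 : X = []
  · subst h0
    refine ⟨?_, fun _ => Or.inl rfl⟩
    norm_num [gapProb_two_two, optFactor]
  by_cases h2 : X = [2]
  · subst h2
    refine ⟨?_, fun _ => Or.inr rfl⟩
    norm_num [gapProb_two_two_two, optFactor]
  suffices hlt : 3 * gapProb (2 :: (X ++ [2])) < optFactor X.sum from
    ⟨hlt.le, fun he => absurd he hlt.ne⟩
  have hs4 : 4 ≤ X.sum := by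
    obtain ⟨a, t, rfl⟩ := List.exists_cons_of_ne_nil h0
    have ha := h a (by simp)
    by_cases ht : t = []
    · subst ht
      simp only [List.cons.injEq, and_true] at h2
      simp; omega
    · have := two_le_sum_of_ne_nil ht (fun x hx => h x (by simp [hx]))
      rw [List.sum_cons]; omega
  have hb := gapProb_le 2 (X ++ [2]) (by
    intro x hx
    rw [List.mem_cons, List.mem_append, List.mem_singleton] at hx
    rcases hx with rfl | hx | rfl
    exacts [Or.inl rfl, h x hx, Or.inl rfl])
  have hs : (2 :: (X ++ [2])).sum = X.sum + 4 := by
    rw [List.sum_cons, List.sum_append, List.sum_singleton]; omega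
  rw [getLastD_append_singleton, hs, corr_of_five_le (by omega), weight_two, pow_add] at hb
  have := mul_pow_lt_optFactor (c := 3 * (121 / 100) ^ 2 * (27 / 40) ^ 4) (k := 4) (by norm_num)
    (by norm_num [optFactor]) (by norm_num [optFactor]) (by norm_num [optFactor]) hs4
  linarith

theorem sum_ge_six_or {X : List ℕ} (h : ∀ x ∈ X, x = 2 ∨ 4 ≤ x) :
    X = [] ∨ X = [2] ∨ X = [4] ∨ X = [5] ∨ X = [2, 2] ∨ 6 ≤ X.sum := by
  rcases X with _ | ⟨a, t⟩
  · simp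
  have ha := h a (by simp)
  rcases t with _ | ⟨b, t⟩
  · simp; omega
  have hb := h b (by simp)
  rcases t with _ | ⟨c, t⟩
  · simp; omega
  have hc := h c (by simp)
  simp; omega

/-- A piece without `3` at the right end. -/
theorem gapProb_two_cons_le {X : List ℕ} (h : ∀ x ∈ X, x = 2 ∨ 4 ≤ x) :
    gapProb (2 :: X) ≤ optFactor X.sum ∧
      (gapProb (2 :: X) = optFactor X.sum → X = [] ∨ X = [4]) := by
  rcases sum_ge_six_or h with rfl | rfl | rfl | rfl | rfl | hs6
  · norm_num [gapProb_two, optFactor]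
  · norm_num [gapProb_two_two, optFactor]
  · norm_num [gapProb_two_four, optFactor]
  · norm_num [gapProb_two_five, optFactor]
  · norm_num [gapProb_two_two_two, optFactor]
  suffices hlt : gapProb (2 :: X) < optFactor X.sum from ⟨hlt.le, fun he => absurd he hlt.ne⟩
  have hb := gapProb_le 2 X (by
    intro x hx
    rcases List.mem_cons.1 hx with rfl | hx
    exacts [Or.inl rfl, h x hx])
  have hs : (2 :: X).sum = X.sum + 2 := by rw [List.sum_cons]; omega
  rw [hs, corr_of_five_le (by omega), weight_two, pow_add] at hb
  have := mul_pow_lt_optFactor (c := 121 / 100 * (7 / 4) * (27 / 40) ^ 2) (k := 6) (by norm_num)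
    (by norm_num [optFactor]) (by norm_num [optFactor]) (by norm_num [optFactor]) hs6
  have hw := mul_le_mul_of_nonneg_right (weight_le (X.getLastD 2))
    (show (0 : ℚ) ≤ (27 / 40) ^ X.sum by positivity)
  linarith

/-- A piece without `3` at the left end. -/
theorem gapProb_append_two_le {X : List ℕ} (h : ∀ x ∈ X, x = 2 ∨ 4 ≤ x) :
    gapProb (X ++ [2]) ≤ optFactor X.sum ∧
      (gapProb (X ++ [2]) = optFactor X.sum → X = [] ∨ X = [4]) := by
  rcases sum_ge_six_or h with rfl | rfl | rfl | rfl | rfl | hs6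
  · norm_num [gapProb_two, optFactor]
  · norm_num [gapProb_two_two, optFactor]
  · norm_num [gapProb_four_two, optFactor]
  · norm_num [gapProb_five_two, optFactor]
  · norm_num [gapProb_two_two_two, optFactor]
  suffices hlt : gapProb (X ++ [2]) < optFactor X.sum from ⟨hlt.le, fun he => absurd he hlt.ne⟩
  rcases X with _ | ⟨a, t⟩
  · simp at hs6
  have hb := gapProb_le a (t ++ [2]) (by
    intro x hx
    rw [List.mem_cons, List.mem_append, List.mem_singleton] at hx
    rcases hx with rfl | hx | rfl
    exacts [h x (by simp), h x (by simp [hx]), Or.inl rfl])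
  have hs : (a :: (t ++ [2])).sum = (a :: t).sum + 2 := by
    rw [List.sum_cons, List.sum_append, List.sum_singleton, List.sum_cons]; omega
  rw [hs, corr_of_five_le (by omega), getLastD_append_singleton, weight_two, pow_add] at hb
  have := mul_pow_lt_optFactor (c := 121 / 100 * (7 / 4) * (27 / 40) ^ 2) (k := 6) (by norm_num)
    (by norm_num [optFactor]) (by norm_num [optFactor]) (by norm_num [optFactor]) hs6
  have hw := mul_le_mul_of_nonneg_right (weight_le a)
    (show (0 : ℚ) ≤ (27 / 40) ^ (a :: t).sum by positivity)
  rw [List.cons_append]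
  linarith

theorem gapProb_lt_of_three_notMem {X : List ℕ} (h : ∀ x ∈ X, x = 2 ∨ 4 ≤ x) (h7 : 7 ≤ X.sum) :
    gapProb X < 3 * optFactor X.sum := by
  rcases X with _ | ⟨a, t⟩
  · simp at h7
  have hb := gapProb_le a t h
  rw [corr_of_five_le (by omega)] at hb
  have := mul_pow_lt_optFactor (c := 49 / 48) (k := 7) (by norm_num)
    (by norm_num [optFactor]) (by norm_num [optFactor]) (by norm_num [optFactor]) h7
  have hw := mul_le_mul (weight_le a) (weight_le (t.getLastD a)) (weight_pos _).le (by norm_num)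
  have hw' := mul_le_mul_of_nonneg_right hw
    (show (0 : ℚ) ≤ (27 / 40) ^ (a :: t).sum by positivity)
  linarith

theorem eq_two_or_four_le_of_three_notMem {X : List ℕ} (h : ∀ x ∈ X, 2 ≤ x) (h3 : 3 ∉ X) :
    ∀ x ∈ X, x = 2 ∨ 4 ≤ x := by
  intro x hx
  have := h x hx
  have : x ≠ 3 := by rintro rfl; exact h3 hx
  omega

/-- The lists `D` for which `2 :: D` can attain the bound of `gapProb_two_cons_le_optFactor`. -/
def IsOptTail (D : List ℕ) : Prop :=
  (∃ q, D = List.replicate q 3) ∨ (∃ q, D = List.replicate q 3 ++ [4]) ∨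
    ∃ s t, D = List.replicate s 3 ++ 2 :: List.replicate (t + 1) 3

theorem gapProb_two_cons_le_optFactor (D : List ℕ) (h : ∀ x ∈ D, 2 ≤ x) :
    gapProb (2 :: D) ≤ optFactor D.sum ∧
      (gapProb (2 :: D) = optFactor D.sum → IsOptTail D) := by
  induction hn : D.length using Nat.strong_induction_on generalizing D with
  | _ n ih =>
  by_cases h3 : 3 ∈ D
  · obtain ⟨X, R, rfl, hX⟩ := List.eq_append_cons_of_mem h3
    have hX' := eq_two_or_four_le_of_three_notMem (fun x hx => h x (by simp [hx])) hX
    obtain ⟨i1, i2⟩ := ih R.length (by simp at hn; omega) R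
      (fun x hx => h x (by simp [hx])) rfl
    obtain ⟨j1, j2⟩ := gapProb_two_cons_append_two_le hX'
    obtain ⟨k1, k2⟩ := mul_le_optFactor_add (gapProb_nonneg _) j1 i1
    have hcut := gapProb_append_three_cons (2 :: X) R
    rw [List.cons_append, List.cons_append] at hcut
    have hs : (X ++ 3 :: R).sum = X.sum + R.sum + 3 := by
      rw [List.sum_append, List.sum_cons]; omega
    rw [hcut, hs, optFactor_add_three]
    refine ⟨by linarith, fun he => ?_⟩
    obtain ⟨e1, e2, e3⟩ := k2 (by linarith)
    have hR := i2 e2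
    rcases j2 e1 with rfl | rfl
    · rcases hR with ⟨q, rfl⟩ | ⟨q, rfl⟩ | ⟨s, t, rfl⟩
      · exact Or.inl ⟨q + 1, rfl⟩
      · exact Or.inr (Or.inl ⟨q + 1, rfl⟩)
      · exact Or.inr (Or.inr ⟨s + 1, t, rfl⟩)
    · rcases hR with ⟨q, rfl⟩ | ⟨q, rfl⟩ | ⟨s, t, rfl⟩
      · exact Or.inr (Or.inr ⟨0, q, rfl⟩)
      · simp at e3
      · simp at e3
  · obtain ⟨i1, i2⟩ := gapProb_two_cons_le (eq_two_or_four_le_of_three_notMem h h3)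
    refine ⟨i1, fun he => ?_⟩
    rcases i2 he with rfl | rfl
    · exact Or.inl ⟨0, rfl⟩
    · exact Or.inr (Or.inl ⟨0, rfl⟩)

/-- The gap lists of maximal probability, among those of the same sum if that is at least `7`. -/
def IsOpt (D : List ℕ) : Prop :=
  (∃ k, D = List.replicate (k + 1) 3) ∨ (∃ k, D = List.replicate (k + 1) 3 ++ [4]) ∨
    (∃ k, D = 4 :: List.replicate (k + 1) 3) ∨
    ∃ s t, D = List.replicate (s + 1) 3 ++ 2 :: List.replicate (t + 1) 3

theorem gapProb_le_optFactor {D : List ℕ} (h : ∀ x ∈ D, 2 ≤ x) (h7 : 7 ≤ D.sum) :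
    gapProb D ≤ 3 * optFactor D.sum ∧ (gapProb D = 3 * optFactor D.sum → IsOpt D) := by
  by_cases h3 : 3 ∈ D
  · obtain ⟨X, R, rfl, hX⟩ := List.eq_append_cons_of_mem h3
    have hX' := eq_two_or_four_le_of_three_notMem (fun x hx => h x (by simp [hx])) hX
    obtain ⟨i1, i2⟩ := gapProb_two_cons_le_optFactor R (fun x hx => h x (by simp [hx]))
    obtain ⟨j1, j2⟩ := gapProb_append_two_le hX'
    obtain ⟨k1, k2⟩ := mul_le_optFactor_add (gapProb_nonneg _) j1 i1
    have hs : (X ++ 3 :: R).sum = X.sum + R.sum + 3 := by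
      rw [List.sum_append, List.sum_cons]; omega
    rw [gapProb_append_three_cons, hs, optFactor_add_three]
    refine ⟨by linarith, fun he => ?_⟩
    obtain ⟨e1, e2, e3⟩ := k2 (by linarith)
    have hR := i2 e2
    rcases j2 e1 with rfl | rfl
    · rcases hR with ⟨q, rfl⟩ | ⟨q, rfl⟩ | ⟨s, t, rfl⟩
      · exact Or.inl ⟨q, rfl⟩
      · exact Or.inr (Or.inl ⟨q, rfl⟩)
      · exact Or.inr (Or.inr (Or.inr ⟨s, t, rfl⟩))
    · rcases hR with ⟨q, rfl⟩ | ⟨q, rfl⟩ | ⟨s, t, rfl⟩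
      · exact Or.inr (Or.inr (Or.inl ⟨q, rfl⟩))
      · simp at e3
      · simp at e3
  · have := gapProb_lt_of_three_notMem (eq_two_or_four_le_of_three_notMem h h3) h7
    exact ⟨this.le, fun he => absurd he this.ne⟩

theorem gapProb_two_cons_replicate_append (q : ℕ) (R : List ℕ) :
    gapProb (2 :: (List.replicate q 3 ++ R)) = (1 / 3) ^ q * gapProb (2 :: R) := by
  induction q with
  | zero => simp
  | succ q ih =>
    have := gapProb_append_three_cons [2] (List.replicate q 3 ++ R)
    rw [List.replicate_succ, List.cons_append]
    rw [List.singleton_append, List.singleton_append, gapProb_two_two, ih] at this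
    rw [this, pow_succ]; ring

theorem gapProb_three_cons (R : List ℕ) : gapProb (3 :: R) = gapProb (2 :: R) := by
  have := gapProb_append_three_cons [] R
  rwa [List.nil_append, List.nil_append, gapProb_two, one_mul] at this

theorem gapProb_two_cons_replicate (q : ℕ) :
    gapProb (2 :: List.replicate q 3) = (1 / 3) ^ q := by
  have := gapProb_two_cons_replicate_append q []
  rwa [List.append_nil, gapProb_two, mul_one] at this

theorem IsOpt.gapProb_eq {D : List ℕ} (h : IsOpt D) : gapProb D = 3 * optFactor D.sum := by
  rcases h with ⟨k, rfl⟩ | ⟨k, rfl⟩ | ⟨k, rfl⟩ | ⟨s, t, rfl⟩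
  · have hs : (List.replicate (k + 1) 3).sum = 3 + 3 * k := by simp; ring
    rw [hs, optFactor_add_three_mul, List.replicate_succ, gapProb_three_cons,
      gapProb_two_cons_replicate]
    norm_num [optFactor]
    ring
  · have hs : (List.replicate (k + 1) 3 ++ [4]).sum = 7 + 3 * k := by simp; ring
    rw [hs, optFactor_add_three_mul, List.replicate_succ, List.cons_append, gapProb_three_cons,
      gapProb_two_cons_replicate_append, gapProb_two_four]
    norm_num [optFactor]
    ring
  · have hs : (4 :: List.replicate (k + 1) 3).sum = 7 + 3 * k := by simp; ring
    have hc := gapProb_append_three_cons [4] (List.replicate k 3)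
    rw [List.singleton_append, List.singleton_append, gapProb_four_two,
      gapProb_two_cons_replicate] at hc
    rw [hs, optFactor_add_three_mul, List.replicate_succ, hc]
    norm_num [optFactor]
    ring
  · have hs : (List.replicate (s + 1) 3 ++ 2 :: List.replicate (t + 1) 3).sum =
        8 + 3 * (s + t) := by simp; ring
    have hc := gapProb_append_three_cons [2, 2] (List.replicate t 3)
    simp only [List.cons_append, List.nil_append, gapProb_two_two_two,
      gapProb_two_cons_replicate] at hc
    rw [hs, optFactor_add_three_mul, List.replicate_succ, List.cons_append, gapProb_three_cons,
      gapProb_two_cons_replicate_append, List.replicate_succ, hc, pow_add]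
    norm_num [optFactor]
    ring

theorem exists_isOpt {N : ℕ} (h : 7 ≤ N) : ∃ D, D.sum = N ∧ IsOpt D := by
  obtain ⟨q, hq | hq | hq⟩ : ∃ q, N = 3 * q + 3 ∨ N = 3 * q + 7 ∨ N = 3 * q + 8 := by
    rcases (show N % 3 = 0 ∨ N % 3 = 1 ∨ N % 3 = 2 by omega) with h | h | h
    · exact ⟨N / 3 - 1, by omega⟩
    · exact ⟨N / 3 - 2, by omega⟩
    · exact ⟨N / 3 - 2, by omega⟩
  · exact ⟨List.replicate (q + 1) 3, by simp; omega, Or.inl ⟨q, rfl⟩⟩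
  · exact ⟨List.replicate (q + 1) 3 ++ [4], by simp; omega, Or.inr (Or.inl ⟨q, rfl⟩)⟩
  · refine ⟨List.replicate (q + 1) 3 ++ 2 :: List.replicate (0 + 1) 3, by simp; omega,
      Or.inr (Or.inr (Or.inr ⟨q, 0, rfl⟩))⟩

/-! ### Gap lists and peak sets -/

/-- `i` is the sum of a nonempty proper initial segment of `d`. -/
def IsCut (d : List ℕ) (i : ℕ) : Prop := ∃ u v, u ≠ [] ∧ v ≠ [] ∧ d = u ++ v ∧ u.sum = i

theorem isCut_cons {a : ℕ} {d : List ℕ} {i : ℕ} :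
    IsCut (a :: d) i ↔ (d ≠ [] ∧ i = a) ∨ ∃ i', IsCut d i' ∧ i = i' + a := by
  constructor
  · rintro ⟨u, v, hu, hv, h, rfl⟩
    rcases u with _ | ⟨b, u⟩
    · exact absurd rfl hu
    rw [List.cons_append, List.cons.injEq] at h
    obtain ⟨rfl, rfl⟩ := h
    rcases u with _ | ⟨c, u⟩
    · left; simpa using hv
    · right
      exact ⟨(c :: u).sum, ⟨c :: u, v, by simp, hv, rfl, rfl⟩, by rw [List.sum_cons, add_comm]⟩
  · rintro (⟨h, rfl⟩ | ⟨i', ⟨u, v, hu, hv, rfl, rfl⟩, rfl⟩)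
    · exact ⟨[i], d, by simp, h, rfl, by simp⟩
    · exact ⟨a :: u, v, by simp, hv, rfl, by rw [List.sum_cons, add_comm]⟩

theorem not_isCut_nil (i : ℕ) : ¬ IsCut [] i := by
  rintro ⟨u, v, hu, -, h, -⟩
  exact hu (List.append_eq_nil_iff.1 h.symm).1

theorem not_isCut_singleton (a i : ℕ) : ¬ IsCut [a] i := by
  rw [isCut_cons]
  rintro (⟨h, -⟩ | ⟨i', h, -⟩)
  · exact h rfl
  · exact not_isCut_nil _ h

theorem isCut_modifyHead_succ {d : List ℕ} {i : ℕ} :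
    IsCut (d.modifyHead (· + 1)) i ↔ ∃ i', IsCut d i' ∧ i = i' + 1 := by
  rcases d with _ | ⟨a, t⟩
  · simp [not_isCut_nil]
  · simp only [List.modifyHead_cons, isCut_cons]
    constructor
    · rintro (⟨h, rfl⟩ | ⟨i', h, rfl⟩)
      · exact ⟨a, Or.inl ⟨h, rfl⟩, rfl⟩
      · exact ⟨i' + a, Or.inr ⟨i', h, rfl⟩, by ring⟩
    · rintro ⟨j, (⟨h, rfl⟩ | ⟨i', h, rfl⟩), rfl⟩
      · exact Or.inl ⟨h, rfl⟩
      · exact Or.inr ⟨i', h, by ring⟩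

/-- `i` is a peak of the word `l`, positions being counted from `1`. -/
def IsWordPeak (l : List ℕ) (i : ℕ) : Prop :=
  ∃ j x y z, i = j + 2 ∧ l[j]? = some x ∧ l[j + 1]? = some y ∧ l[j + 2]? = some z ∧ x < y ∧ z < y

theorem isWordPeak_cons_cons_cons {a b c : ℕ} {t : List ℕ} {i : ℕ} :
    IsWordPeak (a :: b :: c :: t) i ↔
      (i = 2 ∧ a < b ∧ c < b) ∨ ∃ i', IsWordPeak (b :: c :: t) i' ∧ i = i' + 1 := by
  constructor
  · rintro ⟨j, x, y, z, rfl, hx, hy, hz, h1, h2⟩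
    rcases j with _ | j
    · simp at hx hy hz
      subst hx hy hz
      exact Or.inl ⟨rfl, h1, h2⟩
    · exact Or.inr ⟨j + 2, ⟨j, x, y, z, rfl, by simpa using hx, by simpa using hy,
        by simpa using hz, h1, h2⟩, rfl⟩
  · rintro (⟨rfl, h1, h2⟩ | ⟨i', ⟨j, x, y, z, rfl, hx, hy, hz, h1, h2⟩, rfl⟩)
    · exact ⟨0, a, b, c, rfl, rfl, rfl, rfl, h1, h2⟩
    · exact ⟨j + 1, x, y, z, rfl, by simpa using hx, by simpa using hy, by simpa using hz, h1, h2⟩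

theorem not_isWordPeak_of_length_le {l : List ℕ} (h : l.length ≤ 2) (i : ℕ) :
    ¬ IsWordPeak l i := by
  rintro ⟨j, x, y, z, -, -, -, hz, -⟩
  rw [List.getElem?_eq_none (by omega)] at hz
  simp at hz

/-- A word descending at its start has no peak there, so dropping its first letter shifts the
peaks. -/
theorem isWordPeak_cons_of_lt {b c : ℕ} {t : List ℕ} (h : c < b) {i : ℕ} :
    IsWordPeak (b :: c :: t) i ↔ ∃ i', IsWordPeak (c :: t) i' ∧ i = i' + 1 := by
  rcases t with _ | ⟨d, t⟩
  · constructor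
    · intro h
      exact absurd h (not_isWordPeak_of_length_le (by simp) i)
    · rintro ⟨i', h, -⟩
      exact absurd h (not_isWordPeak_of_length_le (by simp) i')
  · rw [isWordPeak_cons_cons_cons]
    constructor
    · rintro (⟨-, h1, -⟩ | h)
      · omega
      · exact h
    · exact Or.inr

theorem isCut_gaps : ∀ (l : List ℕ) (i : ℕ), IsCut (gaps l) i ↔ IsWordPeak l i
  | [], i => iff_of_false (not_isCut_nil i) (not_isWordPeak_of_length_le (by simp) i)
  | [_], i => iff_of_false (not_isCut_singleton _ i) (not_isWordPeak_of_length_le (by simp) i)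
  | [_, _], i => iff_of_false (not_isCut_singleton _ i) (not_isWordPeak_of_length_le (by simp) i)
  | a :: b :: c :: t, i => by
    rw [gaps_cons_cons_cons, isWordPeak_cons_cons_cons]
    split_ifs with h
    · have hne : gaps (c :: t) ≠ [] := by rw [Ne, gaps_eq_nil_iff]; simp
      rw [isCut_cons]
      simp only [isCut_gaps (c :: t), isWordPeak_cons_of_lt h.2]
      constructor
      · rintro (⟨-, rfl⟩ | ⟨i', h', rfl⟩)
        · exact Or.inl ⟨rfl, h⟩
        · exact Or.inr ⟨i' + 1, ⟨i', h', rfl⟩, rfl⟩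
      · rintro (⟨rfl, -⟩ | ⟨_, ⟨i', h', rfl⟩, rfl⟩)
        · exact Or.inl ⟨hne, rfl⟩
        · exact Or.inr ⟨i', h', rfl⟩
    · rw [isCut_modifyHead_succ]
      simp only [isCut_gaps (b :: c :: t)]
      constructor
      · exact Or.inr
      · rintro (⟨-, h'⟩ | h')
        · exact absurd h' h
        · exact h'

/-- A list of positive numbers is determined by its sum and its proper partial sums. -/
theorem eq_of_isCut_iff : ∀ {d e : List ℕ}, (∀ x ∈ d, 1 ≤ x) → (∀ x ∈ e, 1 ≤ x) →
    d.sum = e.sum → (∀ i, IsCut d i ↔ IsCut e i) → d = e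
  | [], [], _, _, _, _ => rfl
  | [], b :: e, _, he, hs, _ => by
    have := he b (by simp)
    rw [List.sum_nil, List.sum_cons] at hs; omega
  | a :: d, [], hd, _, hs, _ => by
    have := hd a (by simp)
    rw [List.sum_nil, List.sum_cons] at hs; omega
  | a :: d, b :: e, hd, he, hs, h => by
    have key : ∀ {a b : ℕ} {d e : List ℕ}, d ≠ [] → (∀ i, IsCut (a :: d) i ↔ IsCut (b :: e) i) →
        b ≤ a ∧ e ≠ [] := by
      intro a b d e hd0 h
      rcases isCut_cons.1 ((h a).1 (isCut_cons.2 (Or.inl ⟨hd0, rfl⟩))) with ⟨h1, h2⟩ | ⟨i', h1, h2⟩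
      · exact ⟨h2.ge, h1⟩
      · refine ⟨by omega, ?_⟩
        rintro rfl
        exact not_isCut_nil _ h1
    have hd' : ∀ x ∈ d, 1 ≤ x := fun x hx => hd x (by simp [hx])
    have he' : ∀ x ∈ e, 1 ≤ x := fun x hx => he x (by simp [hx])
    rw [List.sum_cons, List.sum_cons] at hs
    by_cases hd0 : d = []
    · have he0 : e = [] := by
        by_contra he0
        exact (key he0 (fun i => (h i).symm)).2 hd0
      subst hd0 he0
      simpa using hs
    · obtain ⟨h1, he0⟩ := key hd0 h
      obtain rfl : a = b := le_antisymm (key he0 (fun i => (h i).symm)).1 h1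
      have hpos : ∀ {d : List ℕ}, (∀ x ∈ d, 1 ≤ x) → ∀ i, IsCut d i → 1 ≤ i := by
        rintro d hd i ⟨u, v, hu, -, rfl, rfl⟩
        obtain ⟨c, u, rfl⟩ := List.exists_cons_of_ne_nil hu
        have := hd c (by simp)
        rw [List.sum_cons]; omega
      have shift : ∀ {d : List ℕ} {i : ℕ}, 1 ≤ i → (IsCut (a :: d) (i + a) ↔ IsCut d i) := by
        intro d i hi
        rw [isCut_cons]
        constructor
        · rintro (⟨-, h⟩ | ⟨i', h, h'⟩)
          · omega
          · rwa [show i = i' by omega]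
        · exact fun h => Or.inr ⟨i, h, rfl⟩
      congr 1
      refine eq_of_isCut_iff hd' he' (by omega) fun i => ?_
      constructor
      · intro hi
        have hi1 := hpos hd' i hi
        exact (shift hi1).1 ((h _).1 ((shift hi1).2 hi))
      · intro hi
        have hi1 := hpos he' i hi
        exact (shift hi1).1 ((h _).2 ((shift hi1).2 hi))

theorem isCut_modifyLast {d : List ℕ} (f : ℕ → ℕ) {i : ℕ} :
    IsCut (d.modifyLast f) i ↔ IsCut d i := by
  have key : ∀ (t : List ℕ) (a b : ℕ), IsCut (t ++ [a]) i → IsCut (t ++ [b]) i := by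
    rintro t a b ⟨u, v, hu, hv, h, hi⟩
    rcases List.eq_nil_or_concat v with rfl | ⟨w, c, rfl⟩
    · exact absurd rfl hv
    rw [List.concat_eq_append, ← List.append_assoc] at h
    obtain ⟨rfl, -⟩ := List.append_inj' h rfl
    exact ⟨u, w ++ [b], hu, by simp, by simp, hi⟩
  rcases List.eq_nil_or_concat d with rfl | ⟨t, a, rfl⟩
  · rfl
  · rw [List.concat_eq_append, List.modifyLast_concat]
    exact ⟨key t _ _, key t _ _⟩

/-! ### Permutations with a given gap list -/

/-- The one-line word of a permutation, with letters `0, …, n - 1`. -/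
def permWord {n : ℕ} (σ : Equiv.Perm (Fin n)) : List ℕ := List.ofFn fun i => (σ i : ℕ)

theorem length_permWord {n : ℕ} (σ : Equiv.Perm (Fin n)) : (permWord σ).length = n :=
  List.length_ofFn

theorem permWord_injective {n : ℕ} : Function.Injective (permWord (n := n)) := by
  intro σ τ h
  have := List.ofFn_injective h
  ext i
  exact congrFun this i

theorem isPeak_iff_isWordPeak {n : ℕ} (σ : Equiv.Perm (Fin n)) (i : ℕ) :
    IsPeak σ i ↔ IsWordPeak (permWord σ) i := by
  have hget : ∀ j x, (permWord σ)[j]? = some x ↔ ∃ h : j < n, (σ ⟨j, h⟩ : ℕ) = x := by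
    intro j x
    rw [permWord, List.getElem?_ofFn]
    by_cases h : j < n
    · simp [h]
    · simp [h]
  constructor
  · rintro ⟨j, h, rfl, h1, h2⟩
    exact ⟨j, _, _, _, rfl, (hget _ _).2 ⟨by omega, rfl⟩, (hget _ _).2 ⟨by omega, rfl⟩,
      (hget _ _).2 ⟨h, rfl⟩, h1, h2⟩
  · rintro ⟨j, x, y, z, rfl, hx, hy, hz, h1, h2⟩
    obtain ⟨_, rfl⟩ := (hget _ _).1 hx
    obtain ⟨_, rfl⟩ := (hget _ _).1 hy
    obtain ⟨h, rfl⟩ := (hget _ _).1 hz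
    exact ⟨j, h, rfl, h1, h2⟩

theorem mem_peakSet_iff_isCut {n : ℕ} (σ : Equiv.Perm (Fin n)) (i : ℕ) :
    i ∈ peakSet σ ↔ IsCut (gaps (permWord σ)) i := by
  rw [mem_peakSet, isPeak_iff_isWordPeak, isCut_gaps]

theorem permWord_mem_words {n : ℕ} (σ : Equiv.Perm (Fin n)) :
    permWord σ ∈ words (Finset.range n) := by
  rw [mem_words]
  constructor
  · rw [permWord, List.nodup_ofFn]
    exact Fin.val_injective.comp σ.injective
  · ext x
    simp only [permWord, List.mem_toFinset, List.mem_ofFn, Finset.mem_range]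
    constructor
    · rintro ⟨i, rfl⟩
      exact (σ i).isLt
    · intro hx
      exact ⟨σ.symm ⟨x, hx⟩, by simp⟩

theorem exists_permWord_eq {n : ℕ} {l : List ℕ} (hl : l ∈ words (Finset.range n)) :
    ∃ σ : Equiv.Perm (Fin n), permWord σ = l := by
  have hlen : l.length = n := by rw [length_of_mem_words hl, Finset.card_range]
  have hn := (mem_words.1 hl).1
  have hlt : ∀ i : Fin n, l[(i : ℕ)] < n := fun i =>
    Finset.mem_range.1 ((mem_iff_of_mem_words hl).1 (List.getElem_mem _))
  have hinj : Function.Injective fun i : Fin n => (⟨l[(i : ℕ)], hlt i⟩ : Fin n) := by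
    intro i j hij
    rw [Fin.mk.injEq] at hij
    exact Fin.ext ((hn.getElem_inj_iff).1 hij)
  refine ⟨Equiv.ofBijective _ (Finite.injective_iff_bijective.1 hinj), ?_⟩
  apply List.ext_getElem
  · rw [length_permWord, hlen]
  · intro i h1 h2
    simp [permWord]

theorem card_gaps_permWord_eq {n : ℕ} (hn : 1 ≤ n) {d : List ℕ} (hd : d.sum = n + 1) :
    (Nat.card {σ : Equiv.Perm (Fin n) // gaps (permWord σ) = d} : ℚ) =
      n.factorial * gapProb d := by
  rw [← numGaps_range_eq n hd]
  congr 1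
  classical
  rw [Nat.card_eq_fintype_card, Fintype.card_subtype, numGaps]
  refine Finset.card_bij (fun σ _ => permWord σ) ?_ ?_ ?_
  · intro σ hσ
    rw [Finset.mem_filter] at hσ ⊢
    refine ⟨permWord_mem_words σ, ?_, hσ.2⟩
    intro h0
    have := length_permWord σ
    rw [h0, List.length_nil] at this
    omega
  · exact fun σ _ τ _ h => permWord_injective h
  · intro l hl
    rw [Finset.mem_filter] at hl
    obtain ⟨σ, rfl⟩ := exists_permWord_eq hl.1
    exact ⟨σ, by simpa using hl.2.2, rfl⟩

theorem sum_gaps_permWord {n : ℕ} (hn : 1 ≤ n) (σ : Equiv.Perm (Fin n)) :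
    (gaps (permWord σ)).sum = n + 1 := by
  rw [sum_gaps _ (by intro h; have := length_permWord σ; rw [h, List.length_nil] at this; omega),
    length_permWord]

open Classical in
/-- The set of proper partial sums of `d`: the peak set encoded by the gap list `d`. -/
noncomputable def cutSet (d : List ℕ) : Finset ℕ := (Finset.range (d.sum + 1)).filter (IsCut d)

theorem mem_cutSet {d : List ℕ} {i : ℕ} : i ∈ cutSet d ↔ IsCut d i := by
  classical
  rw [cutSet, Finset.mem_filter, Finset.mem_range]
  refine ⟨fun h => h.2, fun h => ⟨?_, h⟩⟩
  obtain ⟨u, v, -, -, rfl, rfl⟩ := h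
  rw [List.sum_append]; omega

theorem peakSet_eq_cutSet {n : ℕ} (σ : Equiv.Perm (Fin n)) :
    peakSet σ = cutSet (gaps (permWord σ)) := by
  ext i
  rw [mem_peakSet_iff_isCut, mem_cutSet]

theorem gaps_permWord_eq_iff {n : ℕ} (hn : 1 ≤ n) (σ : Equiv.Perm (Fin n)) {d : List ℕ}
    (hd : d.sum = n + 1) (h1 : ∀ x ∈ d, 1 ≤ x) :
    gaps (permWord σ) = d ↔ ∀ i, i ∈ peakSet σ ↔ IsCut d i := by
  constructor
  · rintro rfl i
    exact mem_peakSet_iff_isCut σ i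
  · intro h
    refine eq_of_isCut_iff (fun x hx => (two_le_of_mem_gaps _ x hx).trans' (by norm_num)) h1
      (by rw [sum_gaps_permWord hn, hd]) fun i => ?_
    rw [← mem_peakSet_iff_isCut, h]

theorem numPeakSet_cutSet {n : ℕ} (hn : 1 ≤ n) {d : List ℕ} (hd : d.sum = n + 1)
    (h1 : ∀ x ∈ d, 1 ≤ x) : (numPeakSet (cutSet d) n : ℚ) = n.factorial * gapProb d := by
  rw [← card_gaps_permWord_eq hn hd, numPeakSet]
  congr 1
  refine Nat.card_congr (Equiv.subtypeEquivRight fun σ => ?_)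
  rw [gaps_permWord_eq_iff hn σ hd h1, Finset.ext_iff]
  simp only [mem_cutSet]

theorem IsOpt.two_le {D : List ℕ} (h : IsOpt D) : ∀ x ∈ D, 2 ≤ x := by
  rcases h with ⟨k, rfl⟩ | ⟨k, rfl⟩ | ⟨k, rfl⟩ | ⟨s, t, rfl⟩ <;> intro x hx <;>
  simp [List.mem_replicate] at hx <;> omega

theorem numPeakSet_le {n : ℕ} (hn : 6 ≤ n) (S : Finset ℕ) :
    (numPeakSet S n : ℚ) ≤ n.factorial * (3 * optFactor (n + 1)) ∧
      ((numPeakSet S n : ℚ) = n.factorial * (3 * optFactor (n + 1)) →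
        ∃ d, d.sum = n + 1 ∧ IsOpt d ∧ S = cutSet d) := by
  have hf : (0 : ℚ) < n.factorial := by exact_mod_cast n.factorial_pos
  have hG := optFactor_pos (n + 1)
  by_cases h : ∃ σ : Equiv.Perm (Fin n), peakSet σ = S
  · obtain ⟨σ, rfl⟩ := h
    have hs := sum_gaps_permWord (by omega) σ
    have h2 := two_le_of_mem_gaps (permWord σ)
    rw [peakSet_eq_cutSet,
      numPeakSet_cutSet (by omega) hs fun x hx => (h2 x hx).trans' (by norm_num)]
    obtain ⟨i1, i2⟩ := gapProb_le_optFactor h2 (by omega)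
    rw [hs] at i1 i2
    exact ⟨mul_le_mul_of_nonneg_left i1 hf.le, fun he =>
      ⟨_, hs, i2 (mul_left_cancel₀ hf.ne' he), rfl⟩⟩
  · have h0 : numPeakSet S n = 0 := by
      rw [numPeakSet, Nat.card_eq_zero]
      exact Or.inl ⟨fun σ => h ⟨σ.1, σ.2⟩⟩
    rw [h0, Nat.cast_zero]
    have : 0 < (n.factorial : ℚ) * (3 * optFactor (n + 1)) := by positivity
    exact ⟨this.le, fun he => absurd he this.ne⟩

theorem maximalPeakSets_eq {n : ℕ} (hn : 6 ≤ n) :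
    maximalPeakSets n = cutSet '' {d | d.sum = n + 1 ∧ IsOpt d} := by
  have hval : ∀ d : List ℕ, d.sum = n + 1 → IsOpt d →
      (numPeakSet (cutSet d) n : ℚ) = n.factorial * (3 * optFactor (n + 1)) := by
    intro d hd ho
    rw [numPeakSet_cutSet (by omega) hd fun x hx => (ho.two_le x hx).trans' (by norm_num),
      ho.gapProb_eq, hd]
  have hsub : ∀ d : List ℕ, d.sum = n + 1 → IsOpt d → cutSet d ⊆ Finset.Icc 1 n := by
    intro d hd ho i hi
    obtain ⟨u, v, hu, hv, rfl, rfl⟩ := mem_cutSet.1 hi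
    obtain ⟨a, u, rfl⟩ := List.exists_cons_of_ne_nil hu
    obtain ⟨b, v, rfl⟩ := List.exists_cons_of_ne_nil hv
    have ha := ho.two_le a (by simp)
    have hb := ho.two_le b (by simp)
    rw [List.sum_append, List.sum_cons, List.sum_cons] at hd
    rw [Finset.mem_Icc, List.sum_cons]
    omega
  ext S
  constructor
  · rintro ⟨-, hS⟩
    obtain ⟨d, hd, ho⟩ := exists_isOpt (N := n + 1) (by omega)
    have h1 : (numPeakSet (cutSet d) n : ℚ) ≤ numPeakSet S n := by
      exact_mod_cast hS _ (hsub d hd ho)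
    rw [hval d hd ho] at h1
    obtain ⟨e, he, heo, rfl⟩ := (numPeakSet_le hn S).2 (le_antisymm (numPeakSet_le hn S).1 h1)
    exact ⟨e, ⟨he, heo⟩, rfl⟩
  · rintro ⟨d, ⟨hd, ho⟩, rfl⟩
    refine ⟨hsub d hd ho, fun T _ => ?_⟩
    have := (numPeakSet_le hn T).1
    rw [← hval d hd ho] at this
    exact_mod_cast this

/-! ### Peak compositions -/

theorem mem_boundaries_iff {n : ℕ} (c : Composition n) (i : Fin (n + 1)) :
    i ∈ c.boundaries ↔ i = 0 ∨ IsCut c.blocks i ∨ i = Fin.last n := by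
  rw [Composition.boundaries, Finset.mem_map]
  simp only [Finset.mem_univ, true_and, Composition.boundary, RelEmbedding.coe_toEmbedding,
    OrderEmbedding.coe_ofStrictMono, Fin.ext_iff, Composition.sizeUpTo, Fin.val_zero, Fin.val_last]
  constructor
  · rintro ⟨k, hk⟩
    rw [← hk]
    by_cases h1 : c.blocks.take k = []
    · left; rw [h1, List.sum_nil]
    by_cases h2 : c.blocks.drop k = []
    · right; right
      have := List.sum_take_add_sum_drop c.blocks k
      rw [h2, List.sum_nil, add_zero, c.blocks_sum] at this
      exact this
    · exact Or.inr (Or.inl ⟨_, _, h1, h2, (List.take_append_drop _ _).symm, rfl⟩)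
  · rintro (h | ⟨u, v, hu, hv, h, hi⟩ | h)
    · exact ⟨0, by simp [h]⟩
    · refine ⟨⟨u.length, ?_⟩, ?_⟩
      · rw [← c.blocks_length, h, List.length_append]; omega
      · change (c.blocks.take u.length).sum = i
        rw [h, List.take_left, hi]
    · refine ⟨Fin.last _, ?_⟩
      rw [Fin.val_last, h, ← c.blocks_length, List.take_length, c.blocks_sum]

theorem composition_eq_of_boundaries_eq {n : ℕ} {c c' : Composition n}
    (h : c.boundaries = c'.boundaries) : c = c' :=
  (compositionEquiv n).injective (CompositionAsSet.ext h)

/-- The composition of `n` obtained from a gap list by lowering its last part by one. -/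
def gapComposition {n : ℕ} (d : List ℕ) (hd : d.sum = n + 1) (h2 : ∀ x ∈ d, 2 ≤ x) :
    Composition n where
  blocks := d.modifyLast (· - 1)
  blocks_pos := by
    intro i hi
    rcases List.eq_nil_or_concat d with rfl | ⟨t, a, rfl⟩
    · simp at hd
    · rw [List.concat_eq_append] at *
      rw [List.modifyLast_concat] at hi
      have := h2 a (by simp)
      rcases List.mem_append.1 hi with hi | hi
      · have := h2 i (by simp [hi]); omega
      · rw [List.mem_singleton] at hi; omega
  blocks_sum := by
    have := modifyLast_pred_sum (d := d) (fun x hx => (h2 x hx).trans' (by norm_num))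
      (by rintro rfl; simp at hd)
    omega

/-- Both sides say that the peaks of `σ` are the proper partial sums of `d`. -/
theorem peakComposition_eq_gapComposition_iff {n : ℕ} (hn : 1 ≤ n) (σ : Equiv.Perm (Fin n))
    (d : List ℕ) (hd : d.sum = n + 1) (h2 : ∀ x ∈ d, 2 ≤ x) :
    peakComposition σ = gapComposition d hd h2 ↔ gaps (permWord σ) = d := by
  have key : ∀ i : Fin (n + 1), i ∈ (peakComposition σ).boundaries ↔
      i = 0 ∨ (i : ℕ) ∈ peakSet σ ∨ i = Fin.last n := by
    intro i
    rw [peakComposition, CompositionAsSet.toComposition_boundaries]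
    simp
  have key' : ∀ i : Fin (n + 1), i ∈ (gapComposition d hd h2).boundaries ↔
      i = 0 ∨ IsCut d i ∨ i = Fin.last n := by
    intro i
    rw [mem_boundaries_iff]
    exact or_congr Iff.rfl (or_congr (isCut_modifyLast _) Iff.rfl)
  -- peaks lie strictly between the two boundaries that every composition has
  have hcut : ∀ {e : List ℕ}, e.sum = n + 1 → (∀ x ∈ e, 2 ≤ x) →
      ∀ i, IsCut e i → 1 ≤ i ∧ i < n := by
    rintro e he h2e i ⟨u, v, hu, hv, rfl, rfl⟩
    obtain ⟨a, u, rfl⟩ := List.exists_cons_of_ne_nil hu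
    obtain ⟨b, v, rfl⟩ := List.exists_cons_of_ne_nil hv
    have ha := h2e a (by simp)
    have hb := h2e b (by simp)
    rw [List.sum_append, List.sum_cons, List.sum_cons] at he
    rw [List.sum_cons]
    omega
  constructor
  · intro h
    rw [gaps_permWord_eq_iff hn σ hd fun x hx => (h2 x hx).trans' (by norm_num)]
    intro i
    have hkk : ∀ j : Fin (n + 1), (j = 0 ∨ (j : ℕ) ∈ peakSet σ ∨ j = Fin.last n) ↔
        (j = 0 ∨ IsCut d j ∨ j = Fin.last n) := fun j => by rw [← key, ← key', h]
    constructor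
    · intro hi
      have hi' := hcut (sum_gaps_permWord hn σ) (two_le_of_mem_gaps _) i
        ((mem_peakSet_iff_isCut σ i).1 hi)
      rcases (hkk ⟨i, by omega⟩).1 (Or.inr (Or.inl hi)) with h | h | h
      · rw [Fin.ext_iff, Fin.val_zero] at h; dsimp only at h; omega
      · exact h
      · rw [Fin.ext_iff, Fin.val_last] at h; dsimp only at h; omega
    · intro hi
      have hi' := hcut hd h2 i hi
      rcases (hkk ⟨i, by omega⟩).2 (Or.inr (Or.inl hi)) with h | h | h
      · rw [Fin.ext_iff, Fin.val_zero] at h; dsimp only at h; omega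
      · exact h
      · rw [Fin.ext_iff, Fin.val_last] at h; dsimp only at h; omega
  · intro h
    apply composition_eq_of_boundaries_eq
    ext i
    rw [key, key', mem_peakSet_iff_isCut, h]

theorem numPeakComposition_gapComposition {n : ℕ} (hn : 1 ≤ n) (d : List ℕ)
    (hd : d.sum = n + 1) (h2 : ∀ x ∈ d, 2 ≤ x) :
    (numPeakComposition (gapComposition d hd h2) : ℚ) = n.factorial * gapProb d := by
  rw [← card_gaps_permWord_eq hn hd, numPeakComposition]
  congr 1
  exact Nat.card_congr (Equiv.subtypeEquivRight fun σ =>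
    peakComposition_eq_gapComposition_iff hn σ d hd h2)

theorem numPeakComposition_le {n : ℕ} (hn : 6 ≤ n) (c : Composition n) :
    (numPeakComposition c : ℚ) ≤ n.factorial * (3 * optFactor (n + 1)) ∧
      ((numPeakComposition c : ℚ) = n.factorial * (3 * optFactor (n + 1)) →
        ∃ d, d.sum = n + 1 ∧ IsOpt d ∧ c.blocks = d.modifyLast (· - 1)) := by
  have hf : (0 : ℚ) < n.factorial := by exact_mod_cast n.factorial_pos
  have hG := optFactor_pos (n + 1)
  by_cases h : ∃ σ : Equiv.Perm (Fin n), peakComposition σ = c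
  · obtain ⟨σ, rfl⟩ := h
    have hs := sum_gaps_permWord (by omega) σ
    have h2 := two_le_of_mem_gaps (permWord σ)
    rw [(peakComposition_eq_gapComposition_iff (by omega) σ _ hs h2).2 rfl,
      numPeakComposition_gapComposition (by omega)]
    obtain ⟨i1, i2⟩ := gapProb_le_optFactor h2 (by omega)
    rw [hs] at i1 i2
    exact ⟨mul_le_mul_of_nonneg_left i1 hf.le, fun he =>
      ⟨_, hs, i2 (mul_left_cancel₀ hf.ne' he), rfl⟩⟩
  · have h0 : numPeakComposition c = 0 := by
      rw [numPeakComposition, Nat.card_eq_zero]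
      exact Or.inl ⟨fun σ => h ⟨σ.1, σ.2⟩⟩
    rw [h0, Nat.cast_zero]
    have : 0 < (n.factorial : ℚ) * (3 * optFactor (n + 1)) := by positivity
    exact ⟨this.le, fun he => absurd he this.ne⟩

theorem blocks_image_maximalCompositions {n : ℕ} (hn : 6 ≤ n) :
    Composition.blocks '' maximalCompositions n =
      (fun d => d.modifyLast (· - 1)) '' {d | d.sum = n + 1 ∧ IsOpt d} := by
  have hval : ∀ (d : List ℕ) (hd : d.sum = n + 1) (ho : IsOpt d),
      (numPeakComposition (gapComposition d hd ho.two_le) : ℚ) =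
        n.factorial * (3 * optFactor (n + 1)) := by
    intro d hd ho
    rw [numPeakComposition_gapComposition (by omega), ho.gapProb_eq, hd]
  ext L
  constructor
  · rintro ⟨c, hc, rfl⟩
    obtain ⟨d, hd, ho⟩ := exists_isOpt (N := n + 1) (by omega)
    have h1 : (numPeakComposition (gapComposition d hd ho.two_le) : ℚ) ≤
        numPeakComposition c := by exact_mod_cast hc _
    rw [hval d hd ho] at h1
    obtain ⟨e, he, heo, h⟩ :=
      (numPeakComposition_le hn c).2 (le_antisymm (numPeakComposition_le hn c).1 h1)
    exact ⟨e, ⟨he, heo⟩, h.symm⟩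
  · rintro ⟨d, ⟨hd, ho⟩, rfl⟩
    refine ⟨gapComposition d hd ho.two_le, fun b => ?_, rfl⟩
    have := (numPeakComposition_le hn b).1
    rw [← hval d hd ho] at this
    exact_mod_cast this

/-! ### Explicit form of the maximizers -/

theorem isCut_replicate_append (s : ℕ) {D : List ℕ} (hD : D ≠ []) (i : ℕ) :
    IsCut (List.replicate s 3 ++ D) i ↔
      (i % 3 = 0 ∧ 1 ≤ i ∧ i ≤ 3 * s) ∨ ∃ i', IsCut D i' ∧ i = i' + 3 * s := by
  induction s generalizing i with
  | zero =>
    simp only [List.replicate_zero, List.nil_append, mul_zero, add_zero]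
    constructor
    · exact fun h => Or.inr ⟨i, h, rfl⟩
    · rintro (h | ⟨i', h, rfl⟩)
      · omega
      · exact h
  | succ s ih =>
    rw [List.replicate_succ, List.cons_append, isCut_cons]
    simp only [ih]
    constructor
    · rintro (⟨-, rfl⟩ | ⟨i', h | ⟨j, hj, rfl⟩, rfl⟩)
      · left; omega
      · left; omega
      · right; exact ⟨j, hj, by ring⟩
    · rintro (h | ⟨j, hj, rfl⟩)
      · by_cases h3 : i = 3
        · left; exact ⟨by simp [hD], h3⟩
        · right; exact ⟨i - 3, Or.inl (by omega), by omega⟩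
      · right; exact ⟨j + 3 * s, Or.inr ⟨j, hj, rfl⟩, by ring⟩

theorem isCut_replicate_append_singleton (s a i : ℕ) :
    IsCut (List.replicate s 3 ++ [a]) i ↔ i % 3 = 0 ∧ 1 ≤ i ∧ i ≤ 3 * s := by
  rw [isCut_replicate_append s (by simp)]
  simp [not_isCut_singleton]

theorem isCut_replicate_succ (s i : ℕ) :
    IsCut (List.replicate (s + 1) 3) i ↔ i % 3 = 0 ∧ 1 ≤ i ∧ i ≤ 3 * s := by
  rw [List.replicate_succ', isCut_replicate_append_singleton]

theorem isCut_cons_replicate_succ (a s i : ℕ) :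
    IsCut (a :: List.replicate (s + 1) 3) i ↔ a ≤ i ∧ (i - a) % 3 = 0 ∧ i - a ≤ 3 * s := by
  rw [isCut_cons]
  simp only [isCut_replicate_succ]
  constructor
  · rintro (⟨-, rfl⟩ | ⟨j, hj, rfl⟩)
    · simp
    · omega
  · intro h
    by_cases h0 : i = a
    · left; exact ⟨by simp, h0⟩
    · right; exact ⟨i - a, by omega, by omega⟩

theorem modifyLast_pred_replicate (k : ℕ) (L : List ℕ) :
    (L ++ List.replicate (k + 1) 3).modifyLast (· - 1) = L ++ List.replicate k 3 ++ [2] := by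
  rw [List.replicate_succ', ← List.append_assoc, List.modifyLast_concat]

theorem sum_replicate_three (k : ℕ) : (List.replicate k 3).sum = 3 * k := by
  rw [List.sum_replicate, smul_eq_mul, mul_comm]

theorem setOf_isOpt_of_mod_eq_zero (m : ℕ) : {d : List ℕ | d.sum = 3 * (m + 2) ∧ IsOpt d} =
    {List.replicate (m + 2) 3} := by
  ext d
  simp only [Set.mem_ofPred_eq, Set.mem_singleton_iff]
  constructor
  · rintro ⟨hs, ⟨k, rfl⟩ | ⟨k, rfl⟩ | ⟨k, rfl⟩ | ⟨s, t, rfl⟩⟩ <;>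
    simp only [List.sum_append, List.sum_cons, List.sum_nil, sum_replicate_three] at hs
    · rw [show k + 1 = m + 2 by omega]
    all_goals omega
  · rintro rfl
    exact ⟨sum_replicate_three _, Or.inl ⟨m + 1, rfl⟩⟩

theorem setOf_isOpt_of_mod_eq_one (m : ℕ) : {d : List ℕ | d.sum = 3 * (m + 2) + 1 ∧ IsOpt d} =
    {List.replicate (m + 1) 3 ++ [4], 4 :: List.replicate (m + 1) 3} := by
  ext d
  simp only [Set.mem_ofPred_eq, Set.mem_insert_iff, Set.mem_singleton_iff]
  constructor
  · rintro ⟨hs, ⟨k, rfl⟩ | ⟨k, rfl⟩ | ⟨k, rfl⟩ | ⟨s, t, rfl⟩⟩ <;>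
    simp only [List.sum_append, List.sum_cons, List.sum_nil, sum_replicate_three] at hs
    · omega
    · left; rw [show k = m by omega]
    · right; rw [show k = m by omega]
    · omega
  · rintro (rfl | rfl) <;>
    simp only [List.sum_append, List.sum_cons, List.sum_nil, sum_replicate_three]
    · exact ⟨by omega, Or.inr (Or.inl ⟨m, rfl⟩)⟩
    · exact ⟨by omega, Or.inr (Or.inr (Or.inl ⟨m, rfl⟩))⟩

theorem setOf_isOpt_of_mod_eq_two (m : ℕ) : {d : List ℕ | d.sum = 3 * (m + 2) + 2 ∧ IsOpt d} =
    {d | ∃ s t, s + t = m ∧ d = List.replicate (s + 1) 3 ++ 2 :: List.replicate (t + 1) 3} := by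
  ext d
  simp only [Set.mem_ofPred_eq]
  constructor
  · rintro ⟨hs, ⟨k, rfl⟩ | ⟨k, rfl⟩ | ⟨k, rfl⟩ | ⟨s, t, rfl⟩⟩ <;>
    simp only [List.sum_append, List.sum_cons, List.sum_nil, sum_replicate_three] at hs
    any_goals omega
    exact ⟨s, t, by omega, rfl⟩
  · rintro ⟨s, t, hst, rfl⟩
    simp only [List.sum_append, List.sum_cons, sum_replicate_three]
    exact ⟨by omega, Or.inr (Or.inr (Or.inr ⟨s, t, rfl⟩))⟩

theorem cutSet_eq_filter {d : List ℕ} {n : ℕ} {p : ℕ → Prop} [DecidablePred p]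
    (h : ∀ i, IsCut d i ↔ (1 ≤ i ∧ i ≤ n) ∧ p i) : cutSet d = (Finset.Icc 1 n).filter p := by
  ext i
  rw [mem_cutSet, h, Finset.mem_filter, Finset.mem_Icc]

theorem theorem1 :
    (∀ ℓ : ℕ, 2 ≤ ℓ →
      (Composition.blocks '' maximalCompositions (3 * ℓ) =
        {List.replicate ℓ 3, [4] ++ List.replicate (ℓ - 2) 3 ++ [2]}) ∧
      (Composition.blocks '' maximalCompositions (3 * ℓ + 1) =
        {L : List ℕ | ∃ s t : ℕ, 1 ≤ s ∧ s + t = ℓ - 1 ∧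
          L = List.replicate s 3 ++ [2] ++ List.replicate t 3 ++ [2]}) ∧
      (Composition.blocks '' maximalCompositions (3 * ℓ + 2) =
        {List.replicate ℓ 3 ++ [2]})) ∧
    (∀ n : ℕ, 6 ≤ n →
      (n % 3 = 0 → maximalPeakSets n =
        {(Finset.Icc 1 (n - 1)).filter (fun i => i % 3 = 0),
         (Finset.Icc 1 (n - 1)).filter (fun i => 4 ≤ i ∧ i % 3 = 1)}) ∧
      (n % 3 = 1 → maximalPeakSets n =
        {S : Finset ℕ | ∃ s : ℕ, 1 ≤ s ∧ s ≤ n / 3 - 1 ∧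
          S = (Finset.Icc 1 (n - 1)).filter
            (fun i => (i % 3 = 0 ∧ i ≤ 3 * s) ∨ (i % 3 = 2 ∧ 3 * s + 2 ≤ i))}) ∧
      (n % 3 = 2 → maximalPeakSets n =
        {(Finset.Icc 1 (n - 1)).filter (fun i => i % 3 = 0)})) := by
  constructor
  · intro ℓ hℓ
    obtain ⟨m, rfl⟩ : ∃ m, ℓ = m + 2 := ⟨ℓ - 2, by omega⟩
    refine ⟨?_, ?_, ?_⟩
    · rw [blocks_image_maximalCompositions (by omega), setOf_isOpt_of_mod_eq_one,
        Set.image_pair, List.modifyLast_concat]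
      have h := modifyLast_pred_replicate m [4]
      rw [List.singleton_append] at h
      rw [h, Nat.add_sub_cancel, ← List.replicate_succ']
    · rw [blocks_image_maximalCompositions (by omega), add_assoc, setOf_isOpt_of_mod_eq_two]
      have h : ∀ s t, (List.replicate (s + 1) 3 ++ 2 :: List.replicate (t + 1) 3).modifyLast
          (· - 1) = List.replicate (s + 1) 3 ++ [2] ++ List.replicate t 3 ++ [2] := fun s t => by
        rw [← modifyLast_pred_replicate, List.append_assoc, List.singleton_append]
      ext L
      constructor
      · rintro ⟨d, ⟨s, t, hst, rfl⟩, rfl⟩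
        exact ⟨s + 1, t, by omega, by omega, h s t⟩
      · rintro ⟨s, t, hs, hst, rfl⟩
        obtain ⟨s, rfl⟩ : ∃ s', s = s' + 1 := ⟨s - 1, by omega⟩
        exact ⟨_, ⟨s, t, by omega, rfl⟩, h s t⟩
    · rw [blocks_image_maximalCompositions (by omega),
        show 3 * (m + 2) + 2 + 1 = 3 * (m + 1 + 2) by ring, setOf_isOpt_of_mod_eq_zero,
        Set.image_singleton]
      have h := modifyLast_pred_replicate (m + 2) []
      rw [List.nil_append, List.nil_append] at h
      rw [h]
  · intro n hn
    rw [maximalPeakSets_eq hn]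
    refine ⟨fun h => ?_, fun h => ?_, fun h => ?_⟩
    · obtain ⟨m, rfl⟩ : ∃ m, n = 3 * (m + 2) := ⟨n / 3 - 2, by omega⟩
      rw [setOf_isOpt_of_mod_eq_one, Set.image_pair,
        cutSet_eq_filter (n := 3 * (m + 2) - 1) (p := fun i => i % 3 = 0),
        cutSet_eq_filter (n := 3 * (m + 2) - 1) (p := fun i => 4 ≤ i ∧ i % 3 = 1)]
      · intro i
        rw [isCut_cons_replicate_succ]
        omega
      · intro i
        rw [isCut_replicate_append_singleton]
        omega
    · obtain ⟨m, rfl⟩ : ∃ m, n = 3 * (m + 2) + 1 := ⟨n / 3 - 2, by omega⟩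
      rw [add_assoc, setOf_isOpt_of_mod_eq_two]
      have hc : ∀ s t, s + t = m →
          cutSet (List.replicate (s + 1) 3 ++ 2 :: List.replicate (t + 1) 3) =
          (Finset.Icc 1 (3 * (m + 2) + 1 - 1)).filter
            (fun i => (i % 3 = 0 ∧ i ≤ 3 * (s + 1)) ∨ (i % 3 = 2 ∧ 3 * (s + 1) + 2 ≤ i)) := by
        intro s t hst
        apply cutSet_eq_filter
        intro i
        rw [isCut_replicate_append _ (by simp)]
        simp only [isCut_cons_replicate_succ]
        constructor
        · rintro (h | ⟨j, hj, rfl⟩) <;> omega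
        · rintro ⟨h1, h2 | h2⟩
          · left; omega
          · right; exact ⟨i - 3 * (s + 1), by omega, by omega⟩
      ext S
      constructor
      · rintro ⟨d, ⟨s, t, hst, rfl⟩, rfl⟩
        exact ⟨s + 1, by omega, by omega, hc s t hst⟩
      · rintro ⟨s, hs, hs', rfl⟩
        obtain ⟨s, rfl⟩ : ∃ s', s = s' + 1 := ⟨s - 1, by omega⟩
        exact ⟨_, ⟨s, m - s, by omega, rfl⟩, hc s (m - s) (by omega)⟩
    · obtain ⟨m, rfl⟩ : ∃ m, n = 3 * (m + 2) + 2 := ⟨n / 3 - 2, by omega⟩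
      rw [show 3 * (m + 2) + 2 + 1 = 3 * (m + 1 + 2) by ring, setOf_isOpt_of_mod_eq_zero,
        Set.image_singleton,
        cutSet_eq_filter (n := 3 * (m + 2) + 2 - 1) (p := fun i => i % 3 = 0)]
      intro i
      rw [isCut_replicate_succ]
      omega
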